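/- **Setting.** A logic $\mathcal L$ consists of a set $S_{\mathcal L}$ of sentences and a class of models with a satisfaction relation; $\mathcal T\models\alpha$ means that every model of all elements of $\mathcal T\subseteq S_{\mathcal L}$ is a model of $\alpha$. Sentences are represented by distinct bit strings, every sentence $\alpha$ has a size $|\alpha|\in\mathbb N$ that is bounded by a fixed polynomial in the length of its representation, and $|\mathcal T|=\sum_{\alpha\in\mathcal T}|\alpha|$ for a finite theory $\mathcal T$. A hypergraph $H=(V,E,\ell)$ has a finite vertex set $V$, a set $E$ of hyperedges $(S,d)$ with $S\subseteq V$, $d\in V$, and a labelling $\ell:V\to S_{\mathcal L}$; its size is $|H|=\sum_{(S,d)\in E}(|\ell(d)|+\sum_{v\in S}|\ell(v)|)$. A leaf is a vertex $v$ with no hyperedge $(S,v)\in E$; a sink is a vertex that lies in $S$ for no $(S,d)\in E$. A path of length $q$ from $s$ to $t$ is a sequence $d_0,(S_1,d_1),d_1,\dots,(S_q,d_q),d_q$ with $d_0=s$, $d_q=t$, $(S_j,d_j)\in E$ and $d_{j-1}\in S_j$ for all $j$; $H$ is acyclic if it has no path of positive length from a vertex to itself. $H$ is a tree if it has a sink $t$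 such that there is exactly one path to $t$ from every vertex $v\ne t$. $H$ is a derivation structure over a finite theory $\mathcal T$ if all its leaves have labels in $\mathcal T$ and $\{\ell(s)\mid s\in S\}\models\ell(d)$ for all $(S,d)\in E$. A proof for $\mathcal T\models\eta$ is an acyclic derivation structure over $\mathcal T$ with exactly one sink, which is labelled by $\eta$; a tree proof is a proof that is a tree. A homomorphism $h:H\to H'$ is a map $V\to V'$ with $\ell'(h(v))=\ell(v)$ for all $v\in V$ and $(h(S),h(d))\in E'$ for all $(S,d)\in E$. A deriver $\mathfrak D$ is given by a set $C_{\mathcal L}\subseteq S_{\mathcal L}$ and a function that assigns to each finite theory $\mathcal T$ and each $\eta\in C_{\mathcal L}$ a derivation structure $\mathfrak D(\mathcal T,\eta)$ over $\mathcal T$ such that $\mathcal T\models\eta$ iff $\mathfrak D(\mathcal T,\eta)$ contains (as a substructure) a proof for $\mathcal T\models\eta$. A proof $\mathcal P$ is admissible w.r.t. $\mathfrak D(\mathcal T,\eta)$ if there is a homomorphism $\mathcal P\to\mathfrak D(\mathcal T,\eta)$. The deriver is exponential if $|\mathfrak D(\mathcal T,\eta)|\le 2^{p(|\mathcal T|+|\eta|)}$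 for some polynomial $p$. $\mathsf{MTP}^{\exp}_{\mathsf{unary}}(\mathfrak D)$, for an exponential deriver $\mathfrak D$, is the problem of deciding, given a finite theory $\mathcal T$ (as a list of sentences), $\eta\in C_{\mathcal L}$, and $n\in\mathbb N$ in unary, whether there is a tree proof for $\mathcal T\models\eta$ with at most $n$ vertices that is admissible w.r.t. $\mathfrak D(\mathcal T,\eta)$. **Oracle access.** The vertices of each $\mathfrak D(\mathcal T,\eta)$ are numbered $v_1,\dots,v_m$, where the binary length of $m$ is bounded by a fixed polynomial in $|\mathcal T|+|\eta|$. On an instance $(\mathcal T,\eta,n)$, a machine accesses $\mathfrak D(\mathcal T,\eta)=(V,E,\ell)$ only through two oracles, each of which answers in one step: given (the binary indices of) vertices $w_1,\dots,w_l$ with $l\ge1$, whether $(\{w_1,\dots,w_{l-1}\},w_l)\in E$; and given (the binary index of) a vertex $w$ and a sentence $\alpha$, whether $\ell(w)=\alpha$. Both answer "no" to malformed queries. **Theorem.** For every exponential deriver $\mathfrak D$ and every such numbering, $\mathsf{MTP}^{\exp}_{\mathsf{unary}}(\mathfrak D)$ is in NP with this oracle access. That is, there are a deterministic oracle machine $M$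 and polynomials $p,q$ such that, on every instance with encoding $x$ and for every certificate $y$, $M$ halts within $p(|x|+|y|)$ steps, and the answer to the instance is "yes" iff $M$ accepts $(x,y)$ for some certificate $y$ with $|y|\le q(|x|)$. -/

import Mathlib

universe u v

namespace MinProof

/-! ### Logics, hypergraphs, proofs -/

/-- A logic with a model-based consequence relation, a size function on sentences, and a
representation of sentences as bit strings (needed to hand sentences to a machine).  The size of a
sentence may be any measure that is polynomially bounded in the length of its representation. -/
structure Logic where
  Sentence : Type u
  Model : Type v
  Sat : Model → Sentence → Prop
  size : Sentence → ℕ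
  enc : Sentence → List Bool
  enc_injective : Function.Injective enc
  size_le : ∃ r : Polynomial ℕ, ∀ α, size α ≤ r.eval (enc α).length

/-- Every model of all sentences of `T` is a model of `α`. -/
def Logic.Entails (L : Logic.{u, v}) (T : Set L.Sentence) (α : L.Sentence) : Prop :=
  ∀ M : L.Model, (∀ β ∈ T, L.Sat M β) → L.Sat M α

/-- The size of a finite theory. -/
def Logic.theorySize (L : Logic.{u, v}) (T : Finset L.Sentence) : ℕ :=
  ∑ α ∈ T, L.size α

/-- Finite directed labelled hypergraphs; a hyperedge is a pair `(S, d)`. -/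
structure Hypergraph (L : Logic.{u, v}) where
  V : Type
  [fintypeV : Fintype V]
  E : Finset (Finset V × V)
  label : V → L.Sentence

attribute [instance] Hypergraph.fintypeV

namespace Hypergraph

variable {L : Logic.{u, v}}

/-- The size of a hypergraph, measured by the labels of its hyperedges. -/
def size (H : Hypergraph L) : ℕ :=
  ∑ e ∈ H.E, (L.size (H.label e.2) + ∑ w ∈ e.1, L.size (H.label w))

/-- No incoming hyperedge. -/
def IsLeaf (H : Hypergraph L) (w : H.V) : Prop := ∀ e ∈ H.E, e.2 ≠ w

/-- No outgoing hyperedge. -/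
def IsSink (H : Hypergraph L) (w : H.V) : Prop := ∀ e ∈ H.E, w ∉ e.1

/-- `H.IsPath s P t`: the hyperedges `P = (S₁,d₁), …, (S_q,d_q)` form a path of length `q` from `s`
to `t`, i.e. with `d₀ = s` one has `d_{j-1} ∈ S_j` for all `j`, and `d_q = t`.  The vertices of the
path are determined by `s` and `P`. -/
def IsPath (H : Hypergraph L) : H.V → List (Finset H.V × H.V) → H.V → Prop
  | s, [], t => s = t
  | s, e :: P, t => e ∈ H.E ∧ s ∈ e.1 ∧ H.IsPath e.2 P t

/-- No cycle, i.e. no path of positive length from a vertex to itself. -/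
def IsAcyclic (H : Hypergraph L) : Prop :=
  ∀ (w : H.V) (P : List (Finset H.V × H.V)), P ≠ [] → ¬ H.IsPath w P w

/-- `H` is a tree with root `t`. -/
def IsTreeWithRoot (H : Hypergraph L) (t : H.V) : Prop :=
  H.IsSink t ∧ ∀ w, w ≠ t → ∃! P, H.IsPath w P t

def IsTree (H : Hypergraph L) : Prop := ∃ t, H.IsTreeWithRoot t

/-- Derivation structures over the finite theory `T`: grounded and sound. -/
def IsDerivationStructure (H : Hypergraph L) (T : Finset L.Sentence) : Prop :=
  (∀ w, H.IsLeaf w → H.label w ∈ T) ∧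
  ∀ e ∈ H.E, L.Entails (H.label '' (e.1 : Set H.V)) (H.label e.2)

/-- `H` is a proof for `T ⊨ η`. -/
def IsProof (H : Hypergraph L) (T : Finset L.Sentence) (η : L.Sentence) : Prop :=
  H.IsDerivationStructure T ∧
  (∃ w, H.IsSink w ∧ (∀ w', H.IsSink w' → w' = w) ∧ H.label w = η) ∧
  H.IsAcyclic

def IsTreeProof (H : Hypergraph L) (T : Finset L.Sentence) (η : L.Sentence) : Prop :=
  H.IsProof T η ∧ H.IsTree

open Classical in
/-- `h` is a homomorphism from `H` to `H'`. -/
def IsHom (H H' : Hypergraph L) (h : H.V → H'.V) : Prop :=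
  (∀ e ∈ H.E, (e.1.image h, h e.2) ∈ H'.E) ∧ ∀ w, H'.label (h w) = H.label w

/-- `H` contains `H'`: up to renaming of vertices, `H'` is a substructure of `H`. -/
def Contains (H H' : Hypergraph L) : Prop :=
  ∃ h : H'.V → H.V, Function.Injective h ∧ H'.IsHom H h

/-- `P` is admissible with respect to `H`. -/
def Admissible (P H : Hypergraph L) : Prop := ∃ h : P.V → H.V, P.IsHom H h

end Hypergraph

/-! ### Derivers -/

/-- A deriver: a set `C` of allowed consequences and a function that assigns to every finite theory
`T` and every `η ∈ C` a derivation structure over `T` that contains a proof for `T ⊨ η` iff `T`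
entails `η`. -/
structure Deriver (L : Logic.{u, v}) where
  C : Set L.Sentence
  out : Finset L.Sentence → C → Hypergraph L
  isDerivationStructure : ∀ T η, (out T η).IsDerivationStructure T
  entails_iff : ∀ (T : Finset L.Sentence) (η : C),
    L.Entails (T : Set L.Sentence) η ↔ ∃ P : Hypergraph L, (out T η).Contains P ∧ P.IsProof T η

namespace Deriver

variable {L : Logic.{u, v}}

/-- Exponential derivers. -/
def IsExponential (D : Deriver L) : Prop :=
  ∃ p : Polynomial ℕ, ∀ (T : Finset L.Sentence) (η : D.C),
    (D.out T η).size ≤ 2 ^ p.eval (L.theorySize T + L.size η)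

/-- A consecutive numbering of the vertices of each output structure. -/
abbrev Numbering (D : Deriver L) :=
  ∀ (T : Finset L.Sentence) (η : D.C), (D.out T η).V ≃ Fin (Fintype.card (D.out T η).V)

/-- The number of vertices, written in binary, has polynomial length, i.e. every vertex can be
addressed by a binary index of polynomial length. -/
def HasPolyIndices (D : Deriver L) : Prop :=
  ∃ p : Polynomial ℕ, ∀ (T : Finset L.Sentence) (η : D.C),
    Nat.size (Fintype.card (D.out T η).V) ≤ p.eval (L.theorySize T + L.size η)

end Deriver

/-! ### Oracle machines and NP -/

/-- The tape alphabet: the two bits and a separator `none`. -/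
abbrev Sym := Option Bool

/-- Instructions of an oracle machine with oracles named by `ι`, stacks named by `K` and control
states `Q`: push a symbol; pop a stack and branch on the symbol read (`none` for an empty stack);
ask whether the content of a stack is in an oracle; halt with a verdict. -/
inductive Instr (ι K Q : Type) where
  | push (k : K) (a : Sym) (next : Q)
  | pop (k : K) (next : Option Sym → Q)
  | query (i : ι) (k : K) (yes no : Q)
  | halt (verdict : Bool)

/-- Deterministic multi-stack (equivalently, multi-tape) oracle machines with a finite control.  Two
distinct stacks hold the input word and the certificate at the start. -/
structure Machine (ι : Type) where
  K : Type
  Q : Type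
  [fintypeK : Fintype K]
  [decEqK : DecidableEq K]
  [fintypeQ : Fintype Q]
  code : Q → Instr ι K Q
  start : Q
  input : K
  cert : K
  input_ne_cert : input ≠ cert

attribute [instance] Machine.decEqK

namespace Machine

variable {ι : Type}

/-- Run for at most `t` steps from state `q` with stack contents `σ` (top first) and oracles `O`.
Every instruction costs one step, also an oracle query and `halt`.  The result is `none` if the
machine has not halted, and its verdict otherwise. -/
def run (M : Machine ι) (O : ι → List Sym → Bool) : ℕ → M.Q → (M.K → List Sym) → Option Bool
  | 0, _, _ => none
  | t + 1, q, σ =>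
    match M.code q with
    | .push k a q' => M.run O t q' (Function.update σ k (a :: σ k))
    | .pop k f => M.run O t (f (σ k).head?) (Function.update σ k (σ k).tail)
    | .query i k q₁ q₀ => M.run O t (if O i (σ k) then q₁ else q₀) σ
    | .halt b => some b

/-- The stacks at the start: the input `x`, the certificate `y`, everything else empty. -/
def init (M : Machine ι) (x y : List Sym) : M.K → List Sym :=
  Function.update (Function.update (fun _ => []) M.input x) M.cert y

/-- The verdict on input `x` with certificate `y` after at most `t` steps. -/
def verdict (M : Machine ι) (O : ι → List Sym → Bool) (t : ℕ) (x y : List Sym) : Option Bool :=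
  M.run O t M.start (M.init x y)

end Machine

/-- A decision problem in which every instance comes with oracles that may be asked while it is
being solved. -/
structure OracleProblem (ι : Type) where
  Inst : Type u
  word : Inst → List Sym
  oracle : Inst → ι → List Sym → Bool
  Yes : Inst → Prop

/-- Membership in NP: some oracle machine halts on every instance and every certificate, in time
polynomial in their total length, and the yes-instances are exactly those that have an accepted
certificate of length polynomial in the length of the instance. -/
def OracleProblem.InNP {ι : Type} (A : OracleProblem.{u} ι) : Prop :=
  ∃ (M : Machine ι) (p q : Polynomial ℕ), ∀ a : A.Inst,
    (∀ y : List Sym,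
      ∃ b, M.verdict (A.oracle a) (p.eval ((A.word a).length + y.length)) (A.word a) y = some b) ∧
    (A.Yes a ↔ ∃ y : List Sym, y.length ≤ q.eval (A.word a).length ∧
      M.verdict (A.oracle a) (p.eval ((A.word a).length + y.length)) (A.word a) y = some true)

/-! ### The problem of finding small tree proofs -/

/-- The names of the two oracles. -/
inductive OracleName where
  | edge
  | label

/-- A bit string, followed by a separator. -/
def field (w : List Bool) : List Sym := w.map some ++ [none]

namespace Deriver

variable {L : Logic.{u, v}}

/-- The index of a vertex (counted from `1`) in binary notation, least significant bit first. -/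
def index (D : Deriver L) (num : D.Numbering) (T : Finset L.Sentence) (η : D.C)
    (w : (D.out T η).V) : List Bool :=
  Nat.bits ((num T η w : ℕ) + 1)

open Classical in
/-- The two oracles for the structure `D(T,η)`.  The edge oracle is true on the list of indices of
`v₁, …, v_l` iff `({v₁, …, v_{l-1}}, v_l)` is a hyperedge; the label oracle is true on the index of
`w` together with a sentence `α` iff `α` is the label of `w`.  Both are false on all other words. -/
noncomputable def oracle (D : Deriver L) (num : D.Numbering) (T : Finset L.Sentence) (η : D.C) :
    OracleName → List Sym → Bool
  | .edge, x => decide (∃ (ws : List (D.out T η).V) (d : (D.out T η).V),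
      x = (ws ++ [d]).flatMap (fun w => field (D.index num T η w)) ∧
      (ws.toFinset, d) ∈ (D.out T η).E)
  | .label, x => decide (∃ (w : (D.out T η).V) (α : L.Sentence),
      x = field (D.index num T η w) ++ field (L.enc α) ∧ (D.out T η).label w = α)

/-- There is a tree proof for `T ⊨ η` with at most `n` vertices that is admissible with respect to
`D(T,η)`. -/
def HasTreeProof (D : Deriver L) (T : Finset L.Sentence) (η : D.C) (n : ℕ) : Prop :=
  ∃ P : Hypergraph L, P.IsTreeProof T η ∧ P.Admissible (D.out T η) ∧ Fintype.card P.V ≤ n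

open Classical in
/-- The problem of deciding, given a finite theory `T` (as a list of its sentences), `η ∈ C`, and
`n` in unary, whether there is an admissible tree proof with at most `n` vertices, with oracle
access to `D(T,η)`. -/
noncomputable def MTPUnary (D : Deriver L) (num : D.Numbering) : OracleProblem OracleName where
  Inst := List L.Sentence × D.C × ℕ
  word := fun (l, η, n) =>
    field (L.enc η) ++ field (List.replicate n true) ++ l.flatMap (fun α => field (L.enc α))
  oracle := fun (l, η, _) => D.oracle num l.toFinset η
  Yes := fun (l, η, n) => D.HasTreeProof l.toFinset η n

end Deriver

end MinProof

/-! A tree proof with a homomorphism into `D.out T η` is a finite unravelling of that structure, and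
it can be checked with a stack of goals. The goal on top is removed; either its label is in the
theory, or it is replaced by the sources of a hyperedge into it. `DischargeIn` counts these
removals, and `Deriver.hasTreeProof_iff` says that `n` vertices suffice for a tree proof iff `n`
removals suffice, starting from a single vertex labelled `η`. From a tree proof to a discharge, the
potential is the number of ancestors of the pending goals. It drops with each removal, because the
sources of a hyperedge in a tree have disjoint ancestor sets that avoid the target
(`sum_card_ancestors_lt`). Conversely, a discharge read backwards builds a forest
(`DischargeIn.exists_forest`). With one root it is a tree proof, whose inferences are sound because
they are images of hyperedges of a derivation structure (`Forest.isTreeProof`). The certificate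
records the guessed root and, goal by goal, the chosen sources as binary indices. The machine never
needs the label of an inner vertex: hyperedges go to the edge oracle, and only `η` and the sentences
of the theory go to the label oracle. `exists_verdict` gives soundness and the time bound for
arbitrary certificates, `Accepts.exists_cert` gives short certificates, and `accepts_iff` replaces
words by vertices. -/

namespace MinProof

/-! ### Tree proofs as discharges of a goal stack. -/

namespace Hypergraph

variable {L : Logic.{u, v}}

lemma IsPath.append {H : Hypergraph L} {P Q : List (Finset H.V × H.V)} {a b c : H.V}
    (hP : H.IsPath a P b) (hQ : H.IsPath b Q c) : H.IsPath a (P ++ Q) c := by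
  induction P generalizing a with
  | nil => cases hP; exact hQ
  | cons e P ih => exact ⟨hP.1, hP.2.1, ih hP.2.2⟩

lemma IsPath.target_unique {H : Hypergraph L} {P : List (Finset H.V × H.V)} {a b c : H.V}
    (hb : H.IsPath a P b) (hc : H.IsPath a P c) : b = c := by
  induction P generalizing a with
  | nil => exact hb.symm.trans hc
  | cons e P ih => exact ih hb.2.2 hc.2.2

/-- `DischargeIn H T n gs`: the goals `gs` can be derived from `T` by a forest in the unravelling of
`H` with at most `n` nodes. -/
inductive DischargeIn (H : Hypergraph L) [DecidableEq H.V]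
    (T : Finset L.Sentence) : ℕ → List H.V → Prop
  | nil (n : ℕ) : DischargeIn H T n []
  | leaf {n : ℕ} {d : H.V} {gs : List H.V} (hd : H.label d ∈ T) (h : DischargeIn H T n gs) :
      DischargeIn H T (n + 1) (d :: gs)
  | edge {n : ℕ} {d : H.V} {ws gs : List H.V} (hd : (ws.toFinset, d) ∈ H.E)
      (h : DischargeIn H T n (ws ++ gs)) : DischargeIn H T (n + 1) (d :: gs)

open Classical in
/-- The vertices from which there is a path to `d`. -/
noncomputable def ancestors (H : Hypergraph L) (d : H.V) : Finset H.V :=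
  Finset.univ.filter fun w => ∃ P, H.IsPath w P d

open Classical in
-- A common ancestor of two sources would have two paths to the root through the same hyperedge,
-- equal by uniqueness, so the sources agree. Acyclicity keeps `d` out of the ancestor sets of its
-- sources, while `d` is its own ancestor by the empty path; hence the strict inequality.
lemma IsTreeWithRoot.sum_card_ancestors_lt {H : Hypergraph L} {t : H.V} (ht : H.IsTreeWithRoot t)
    (hac : H.IsAcyclic) {S : Finset H.V} {d : H.V} (he : (S, d) ∈ H.E) :
    ∑ s ∈ S, (H.ancestors s).card < (H.ancestors d).card := by
  have hdt : ∃ P, H.IsPath d P t := by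
    by_cases h : d = t
    · exact ⟨[], h⟩
    · exact (ht.2 d h).exists
  obtain ⟨R, hR⟩ := hdt
  have hsub : ∀ s ∈ S, ∀ w P, H.IsPath w P s → H.IsPath w (P ++ [(S, d)]) d :=
    fun s hs w P hP => hP.append ⟨he, hs, rfl⟩
  have hdisj : (S : Set H.V).PairwiseDisjoint H.ancestors := by
    intro s hs s' hs' hne
    refine Finset.disjoint_left.2 fun w hw hw' => hne ?_
    obtain ⟨P, hP⟩ := (Finset.mem_filter.1 hw).2
    obtain ⟨P', hP'⟩ := (Finset.mem_filter.1 hw').2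
    have h1 := (hsub s hs w P hP).append hR
    have h2 := (hsub s' hs' w P' hP').append hR
    have hwt : w ≠ t := by
      rintro rfl
      exact hac _ _ (by simp) h1
    have := (ht.2 w hwt).unique h1 h2
    -- Cancelling the common tail through `(S, d)` and `R` leaves equal initial paths, whose
    -- endpoints are `s` and `s'`.
    simp only [List.append_assoc, List.append_cancel_right_eq] at this
    subst this
    exact hP.target_unique hP'
  rw [← Finset.card_biUnion hdisj]
  refine Finset.card_lt_card ((Finset.ssubset_iff_of_subset ?_).2 ⟨d, ?_, ?_⟩)
  · intro w hw
    obtain ⟨s, hs, hw⟩ := Finset.mem_biUnion.1 hw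
    obtain ⟨P, hP⟩ := (Finset.mem_filter.1 hw).2
    exact Finset.mem_filter.2 ⟨Finset.mem_univ _, _, hsub s hs w P hP⟩
  · exact Finset.mem_filter.2 ⟨Finset.mem_univ _, [], rfl⟩
  · intro hw
    obtain ⟨s, hs, hw⟩ := Finset.mem_biUnion.1 hw
    obtain ⟨P, hP⟩ := (Finset.mem_filter.1 hw).2
    exact hac _ _ (by simp) (hsub s hs d P hP)

open Classical in
lemma IsTreeWithRoot.dischargeIn {P H : Hypergraph L} {T : Finset L.Sentence} {t : P.V}
    (ht : P.IsTreeWithRoot t) (hac : P.IsAcyclic) (hleaf : ∀ w, P.IsLeaf w → P.label w ∈ T)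
    {h : P.V → H.V} (hh : P.IsHom H h) (n : ℕ) (gs : List P.V)
    (hn : (gs.map fun g => (P.ancestors g).card).sum ≤ n) : H.DischargeIn T n (gs.map h) := by
  induction n generalizing gs with
  | zero =>
    cases gs with
    | nil => exact .nil _
    | cons d gs =>
      have : 0 < (P.ancestors d).card :=
        Finset.card_pos.2 ⟨d, Finset.mem_filter.2 ⟨Finset.mem_univ _, [], rfl⟩⟩
      simp only [List.map_cons, List.sum_cons] at hn
      omega
  | succ n ih =>
    cases gs with
    | nil => exact .nil _
    | cons d gs =>
      have hpos : 0 < (P.ancestors d).card :=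
        Finset.card_pos.2 ⟨d, Finset.mem_filter.2 ⟨Finset.mem_univ _, [], rfl⟩⟩
      simp only [List.map_cons, List.sum_cons] at hn
      by_cases hd : P.IsLeaf d
      · exact .leaf (by rw [hh.2]; exact hleaf d hd) (ih gs (by omega))
      -- Several hyperedges may end in `d`; any one of them justifies it, and the others are
      -- dropped.
      · obtain ⟨⟨S, d'⟩, he, rfl⟩ : ∃ e ∈ P.E, e.2 = d := by
          simpa [IsLeaf] using hd
        have hlt := ht.sum_card_ancestors_lt hac he
        -- This list has repetitions if `h` identifies sources; each copy stays a goal of its own.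
        refine .edge (ws := S.toList.map h) ?_ ?_
        · have := hh.1 _ he
          convert this using 2
          ext w
          simp
        · rw [← List.map_append]
          refine ih _ ?_
          rw [List.map_append, List.sum_append, Finset.sum_map_toList]
          simp only at hn hlt ⊢
          omega

/-- A forest on the vertices `0, …, m - 1` with the given roots, labelled by vertices of `H`;
`inner` marks the vertices that are the target of a hyperedge. -/
structure Forest (H : Hypergraph L) [DecidableEq H.V]
    (T : Finset L.Sentence) (m : ℕ) (roots : List ℕ) where
  map : ℕ → H.V
  parent : ℕ → ℕ
  inner : ℕ → Bool
  nodup : roots.Nodup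
  roots_lt : ∀ r ∈ roots, r < m
  parent_spec : ∀ i < m, i ∉ roots → i < parent i ∧ parent i < m ∧ inner (parent i) = true
  label_mem : ∀ i < m, inner i = false → H.label (map i) ∈ T
  edge_mem : ∀ i < m, inner i = true →
    (((Finset.range m).filter fun j => j ∉ roots ∧ parent j = i).image map, map i) ∈ H.E

/-- The induction undoes one removal at a time. The restored goal becomes the vertex `m`, larger
than all existing ones, so parents always exceed their children. The flag `inner` separates a leaf
from the target of a hyperedge without sources. -/
lemma DischargeIn.exists_forest {H : Hypergraph L} [DecidableEq H.V] [Nonempty H.V]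
    {T : Finset L.Sentence} {n : ℕ} {gs : List H.V} (hd : H.DischargeIn T n gs) :
    ∃ m ≤ n, ∃ roots, ∃ F : Forest H T m roots, roots.map F.map = gs := by
  induction hd with
  | nil n =>
    exact ⟨0, n.zero_le, [], ⟨fun _ => Classical.arbitrary H.V, id, fun _ => true, by simp,
      by simp, by simp, by simp, by simp⟩, rfl⟩
  | @leaf n d gs hd _ ih =>
    obtain ⟨m, hm, roots, F, rfl⟩ := ih
    have hmr : m ∉ roots := fun h => (F.roots_lt m h).false
    refine ⟨m + 1, by omega, m :: roots, ⟨Function.update F.map m d, F.parent,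
      Function.update F.inner m false, by simp [hmr, F.nodup], ?_, ?_, ?_, ?_⟩, ?_⟩
    · simp only [List.mem_cons, forall_eq_or_imp]
      exact ⟨by omega, fun r hr => (F.roots_lt r hr).trans (by omega)⟩
    · intro i hi hir
      simp only [List.mem_cons, not_or] at hir
      obtain ⟨h1, h2, h3⟩ := F.parent_spec i (by omega) hir.2
      exact ⟨h1, by omega, by rw [Function.update_of_ne (by omega), h3]⟩
    · intro i hi hin
      by_cases him : i = m
      · subst him; simpa using hd
      · rw [Function.update_of_ne him] at hin ⊢
        exact F.label_mem i (by omega) hin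
    · intro i hi hin
      have him : i ≠ m := by rintro rfl; simp at hin
      rw [Function.update_of_ne him] at hin ⊢
      convert F.edge_mem i (by omega) hin using 2
      have : ((Finset.range (m + 1)).filter fun j => j ∉ m :: roots ∧ F.parent j = i) =
          (Finset.range m).filter fun j => j ∉ roots ∧ F.parent j = i := by
        ext j; simp only [Finset.mem_filter, Finset.mem_range, List.mem_cons]; grind
      rw [this]
      refine Finset.image_congr fun j hj => ?_
      simp only [Finset.coe_filter, Finset.mem_range, Set.mem_ofPred_eq] at hj
      exact Function.update_of_ne (by omega) _ _
    · simp only [List.map_cons, Function.update_self, List.cons.injEq, true_and]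
      exact List.map_congr_left fun r hr => Function.update_of_ne (F.roots_lt r hr).ne _ _
  | @edge n d ws gs hd _ ih =>
    obtain ⟨m, hm, roots, F, hF⟩ := ih
    obtain ⟨as, bs, rfl, rfl, rfl⟩ := List.map_eq_append_iff.1 hF
    have hlt := F.roots_lt
    have hnd := List.nodup_append.1 F.nodup
    simp only [List.mem_append] at hlt
    have hmb : m ∉ bs := fun h => (hlt m (.inr h)).false
    -- The roots `as` standing for the sources `ws` become the children of the new vertex `m`; the
    -- roots `bs` stay roots.
    refine ⟨m + 1, by omega, m :: bs, ⟨Function.update F.map m d,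
      fun i => if i ∈ as then m else F.parent i,
      Function.update F.inner m true, by simp [hmb, hnd.2.1], ?_, ?_, ?_, ?_⟩, ?_⟩
    · simp only [List.mem_cons, forall_eq_or_imp]
      exact ⟨by omega, fun r hr => (hlt r (.inr hr)).trans (by omega)⟩
    · intro i hi hir
      simp only [List.mem_cons, not_or] at hir
      by_cases hia : i ∈ as
      · simp only [hia, if_true, Function.update_self]
        exact ⟨by omega, by omega, trivial⟩
      · obtain ⟨h1, h2, h3⟩ := F.parent_spec i (by omega) (by simp [hia, hir.2])
        simp only [hia, if_false]
        exact ⟨h1, by omega, by rw [Function.update_of_ne (by omega), h3]⟩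
    · intro i hi hin
      have him : i ≠ m := by rintro rfl; simp at hin
      rw [Function.update_of_ne him] at hin ⊢
      exact F.label_mem i (by omega) hin
    · intro i hi hin
      by_cases him : i = m
      · subst him
        -- Old non-roots have parents below `m`, and `as` is disjoint from `bs` since the roots have
        -- no repetition.
        have : ((Finset.range (i + 1)).filter fun j =>
            j ∉ i :: bs ∧ (if j ∈ as then i else F.parent j) = i) = as.toFinset := by
          ext j
          simp only [Finset.mem_filter, Finset.mem_range, List.mem_cons, List.mem_toFinset]
          have := F.parent_spec j
          simp only [List.mem_append] at this
          grind
        rw [this, Function.update_self]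
        convert hd using 2
        ext w
        simp only [Finset.mem_image, List.mem_toFinset, List.mem_map]
        refine exists_congr fun r => and_congr_right fun hr => ?_
        rw [Function.update_of_ne (hlt r (.inl hr)).ne]
      · rw [Function.update_of_ne him] at hin ⊢
        convert F.edge_mem i (by omega) hin using 2
        have : ((Finset.range (m + 1)).filter fun j =>
              j ∉ m :: bs ∧ (if j ∈ as then m else F.parent j) = i) =
            (Finset.range m).filter fun j => j ∉ as ++ bs ∧ F.parent j = i := by
          ext j
          simp only [Finset.mem_filter, Finset.mem_range, List.mem_cons, List.mem_append]
          grind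
        rw [this]
        refine Finset.image_congr fun j hj => ?_
        simp only [Finset.coe_filter, Finset.mem_range, Set.mem_ofPred_eq] at hj
        exact Function.update_of_ne (by omega) _ _
    · simp only [List.map_cons, Function.update_self, List.cons.injEq, true_and]
      exact List.map_congr_left fun r hr => Function.update_of_ne (hlt r (.inr hr)).ne _ _

/-- The hypergraph of a forest with a single root. -/
abbrev Forest.toHypergraph {H : Hypergraph L} [DecidableEq H.V] {T : Finset L.Sentence} {m t : ℕ}
    (F : Forest H T m [t]) : Hypergraph L where
  V := Fin m
  E := (Finset.univ.filter fun i : Fin m => F.inner i = true).image fun i : Fin m =>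
    (Finset.univ.filter fun j : Fin m => (j : ℕ) ≠ t ∧ F.parent j = (i : ℕ), i)
  label i := H.label (F.map i)

namespace Forest

variable {H : Hypergraph L} [DecidableEq H.V] {T : Finset L.Sentence} {m t : ℕ}

/-- Each inner vertex is the target of exactly one hyperedge, so a hyperedge is determined by its
target. -/
lemma mem_edges (F : Forest H T m [t]) {e : Finset (Fin m) × Fin m} :
    e ∈ F.toHypergraph.E ↔ F.inner e.2 = true ∧
      ∀ j : Fin m, j ∈ e.1 ↔ (j : ℕ) ≠ t ∧ F.parent j = e.2 := by
  obtain ⟨S, d⟩ := e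
  simp only [Finset.mem_image, Finset.mem_filter, Finset.mem_univ, true_and,
    Prod.mk.injEq]
  constructor
  · rintro ⟨i, hi, rfl, rfl⟩
    simpa using hi
  · rintro ⟨hd, hS⟩
    refine ⟨d, hd, ?_, rfl⟩
    ext j
    simp [hS]

lemma eq_or_lt_of_isPath (F : Forest H T m [t]) {P : List (Finset (Fin m) × Fin m)}
    {a b : Fin m} (hP : F.toHypergraph.IsPath a P b) : P ≠ [] → a < b := by
  induction P generalizing a with
  | nil => simp
  | cons e P ih =>
    intro _
    obtain ⟨he, ha, hP⟩ := hP
    obtain ⟨-, h⟩ := F.mem_edges.1 he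
    obtain ⟨hat, hpar⟩ := (h a).1 ha
    have hlt : a < e.2 := by
      have := (F.parent_spec a a.2 (by simpa using hat)).1
      rw [hpar] at this
      exact this
    by_cases hPn : P = []
    · subst hPn
      cases hP
      exact hlt
    · exact hlt.trans (ih hP hPn)

/-- The next target on a path is forced to be the parent of the current vertex. Neither path can
continue beyond the other, because targets increase strictly along a path. -/
lemma isPath_unique (F : Forest H T m [t]) {P Q : List (Finset (Fin m) × Fin m)}
    {a b : Fin m} (hP : F.toHypergraph.IsPath a P b)
    (hQ : F.toHypergraph.IsPath a Q b) : P = Q := by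
  have hsink : ∀ e R, ¬ F.toHypergraph.IsPath b (e :: R) b := fun e R h =>
    (F.eq_or_lt_of_isPath h (by simp)).false
  induction P generalizing a Q with
  | nil =>
    cases hP
    cases Q with
    | nil => rfl
    | cons e Q => exact (hsink _ _ hQ).elim
  | cons e P ih =>
    cases Q with
    | nil => cases hQ; exact (hsink _ _ hP).elim
    | cons e' Q =>
      obtain ⟨h1, h2⟩ := F.mem_edges.1 hP.1
      obtain ⟨h1', h2'⟩ := F.mem_edges.1 hQ.1
      have hd : e.2 = e'.2 := Fin.ext (((h2 a).1 hP.2.1).2.symm.trans ((h2' a).1 hQ.2.1).2)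
      have hee : e = e' := by
        refine Prod.ext ?_ hd
        ext j
        rw [h2, h2', hd]
      subst hee
      rw [ih hP.2.2 hQ.2.2]

lemma exists_isPath (F : Forest H T m [t]) (a b : Fin m) (hb : (b : ℕ) = t) :
    ∃ P, F.toHypergraph.IsPath a P b := by
  by_cases hat : (a : ℕ) = t
  · exact ⟨[], Fin.ext (hat.trans hb.symm)⟩
  · obtain ⟨h1, h2, h3⟩ := F.parent_spec a a.2 (by simpa using hat)
    obtain ⟨P, hP⟩ := F.exists_isPath ⟨F.parent a, h2⟩ b hb
    exact ⟨(Finset.univ.filter fun j : Fin m => (j : ℕ) ≠ t ∧ F.parent j = F.parent a,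
      ⟨F.parent a, h2⟩) :: P, F.mem_edges.2 ⟨h3, by simp⟩, by simp [hat], hP⟩
termination_by m - a

open Classical in
lemma isHom (F : Forest H T m [t]) : F.toHypergraph.IsHom H fun i : Fin m => F.map i := by
  refine ⟨fun e he => ?_, fun w => rfl⟩
  obtain ⟨h1, h2⟩ := F.mem_edges.1 he
  convert F.edge_mem (e.2 : Fin m) (e.2 : Fin m).2 h1 using 2
  ext w
  simp only [Finset.mem_image, Finset.mem_filter, Finset.mem_range, List.mem_singleton]
  constructor
  · rintro ⟨j, hj, rfl⟩
    exact ⟨j, ⟨j.2, (h2 j).1 hj⟩, rfl⟩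
  · rintro ⟨j, ⟨hj, hj'⟩, rfl⟩
    exact ⟨⟨j, hj⟩, (h2 _).2 hj', rfl⟩

lemma isTreeProof (F : Forest H T m [t]) (hH : H.IsDerivationStructure T) :
    F.toHypergraph.IsTreeProof T (H.label (F.map t)) := by
  have htm : t < m := F.roots_lt t (by simp)
  have hsink : F.toHypergraph.IsSink (⟨t, htm⟩ : Fin m) := fun e he h => by
    simpa using ((F.mem_edges.1 he).2 _).1 h
  refine ⟨⟨⟨?_, ?_⟩, ⟨⟨t, htm⟩, hsink, ?_, rfl⟩, ?_⟩, ⟨t, htm⟩, hsink, fun w _ => ?_⟩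
  · intro w hw
    refine F.label_mem w w.2 ?_
    -- An inner vertex is the target of a hyperedge even if it has no children.
    by_contra h
    exact hw (Finset.univ.filter fun j : Fin m => (j : ℕ) ≠ t ∧ F.parent j = (w : Fin m), w)
      (F.mem_edges.2 ⟨by simpa using h, by simp⟩) rfl
  · intro e he
    have := hH.2 _ (F.isHom.1 e he)
    convert this using 1
    ext α
    simp
  · intro w hw
    by_contra hne
    have hwt : (w : Fin m) ≠ t := fun h => hne (Fin.ext h)
    obtain ⟨-, h2, h3⟩ := F.parent_spec (w : Fin m) (w : Fin m).2 (by simpa using hwt)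
    exact hw (Finset.univ.filter fun j : Fin m => (j : ℕ) ≠ t ∧
      F.parent j = F.parent (w : Fin m), ⟨F.parent (w : Fin m), h2⟩)
      (F.mem_edges.2 ⟨h3, by simp⟩) (by simp [hwt])
  · exact fun w P hP h => (F.eq_or_lt_of_isPath h hP).false
  · obtain ⟨P, hP⟩ := F.exists_isPath w ⟨t, htm⟩ rfl
    exact ⟨P, hP, fun Q hQ => F.isPath_unique hQ hP⟩

end Forest

end Hypergraph

open Classical in
theorem Deriver.hasTreeProof_iff {L : Logic.{u, v}} (D : Deriver L) (T : Finset L.Sentence)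
    (η : D.C) (n : ℕ) : D.HasTreeProof T η n ↔
      ∃ w, (D.out T η).label w = η ∧ (D.out T η).DischargeIn T n [w] := by
  constructor
  · rintro ⟨P, ⟨⟨hder, ⟨r, -, hr, hrη⟩, hac⟩, t, ht⟩, ⟨h, hh⟩, hn⟩
    -- The root of the tree is a sink, hence the unique sink, which carries the label `η`.
    obtain rfl := hr t ht.1
    refine ⟨h t, (hh.2 t).trans hrη, ht.dischargeIn hac hder.1 hh n [t] ?_⟩
    simpa using (Finset.card_le_univ _).trans hn
  · rintro ⟨w, hw, hd⟩
    have : Nonempty (D.out T η).V := ⟨w⟩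
    obtain ⟨m, hm, roots, F, hF⟩ := hd.exists_forest
    obtain ⟨t, rfl, rfl⟩ := List.map_eq_singleton_iff.1 hF
    refine ⟨F.toHypergraph, ?_, ⟨_, F.isHom⟩, ?_⟩
    · rw [← hw]
      exact F.isTreeProof (D.isDerivationStructure T η)
    · exact (Fintype.card_fin m).le.trans hm

/-! ### Composition of machine runs. -/

namespace Machine

variable {ι : Type} {M : Machine ι} {O : ι → List Sym → Bool}

lemma run_mono {t t' : ℕ} (h : t ≤ t') {q : M.Q} {σ : M.K → List Sym} {b : Bool}
    (hb : M.run O t q σ = some b) : M.run O t' q σ = some b := by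
  induction t generalizing t' q σ with
  | zero => simp [run] at hb
  | succ t ih =>
    obtain ⟨t', rfl⟩ : ∃ s, t' = s + 1 := ⟨t' - 1, by omega⟩
    have ht : t ≤ t' := by omega
    unfold run at hb ⊢
    split at hb
    · exact ih ht hb
    · exact ih ht hb
    · exact ih ht hb
    · exact hb

/-- The configuration `(q', σ')` is reached from `(q, σ)` after at most `t` steps. -/
def Reach (M : Machine ι) (O : ι → List Sym → Bool) (t : ℕ) (q : M.Q) (σ : M.K → List Sym)
    (q' : M.Q) (σ' : M.K → List Sym) : Prop :=
  ∃ t' ≤ t, ∀ s, M.run O (t' + s) q σ = M.run O s q' σ'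

lemma Reach.refl (t : ℕ) (q : M.Q) (σ : M.K → List Sym) : M.Reach O t q σ q σ :=
  ⟨0, t.zero_le, fun s => by rw [zero_add]⟩

lemma Reach.trans {t₁ t₂ : ℕ} {q₁ q₂ q₃ : M.Q} {σ₁ σ₂ σ₃ : M.K → List Sym}
    (h₁ : M.Reach O t₁ q₁ σ₁ q₂ σ₂) (h₂ : M.Reach O t₂ q₂ σ₂ q₃ σ₃) :
    M.Reach O (t₁ + t₂) q₁ σ₁ q₃ σ₃ := by
  obtain ⟨s₁, hs₁, h₁⟩ := h₁
  obtain ⟨s₂, hs₂, h₂⟩ := h₂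
  exact ⟨s₁ + s₂, by omega, fun s => by rw [add_assoc, h₁, h₂]⟩

lemma Reach.mono {t t' : ℕ} {q q' : M.Q} {σ σ' : M.K → List Sym} (h : M.Reach O t q σ q' σ')
    (ht : t ≤ t') : M.Reach O t' q σ q' σ' :=
  let ⟨s, hs, h⟩ := h
  ⟨s, hs.trans ht, h⟩

lemma Reach.run_eq {t s : ℕ} {q q' : M.Q} {σ σ' : M.K → List Sym} {b : Bool}
    (h : M.Reach O t q σ q' σ') (hb : M.run O s q' σ' = some b) :
    M.run O (t + s) q σ = some b := by
  obtain ⟨t', ht', h⟩ := h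
  exact run_mono (by omega) ((h s).trans hb)

lemma Reach.push {t : ℕ} {q q₁ q' : M.Q} {σ σ' : M.K → List Sym} {k : M.K} {a : Sym}
    (h : M.code q = .push k a q₁)
    (h' : M.Reach O t q₁ (Function.update σ k (a :: σ k)) q' σ') : M.Reach O (t + 1) q σ q' σ' := by
  obtain ⟨t', ht', h'⟩ := h'
  exact ⟨t' + 1, by omega, fun s => by rw [add_right_comm, run, h, ← h']⟩

lemma Reach.pop {t : ℕ} {q q' : M.Q} {σ σ' : M.K → List Sym} {k : M.K} {f : Option Sym → M.Q}
    (h : M.code q = .pop k f)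
    (h' : M.Reach O t (f (σ k).head?) (Function.update σ k (σ k).tail) q' σ') :
    M.Reach O (t + 1) q σ q' σ' := by
  obtain ⟨t', ht', h'⟩ := h'
  exact ⟨t' + 1, by omega, fun s => by rw [add_right_comm, run, h, ← h']⟩

lemma Reach.query {t : ℕ} {q q₁ q₀ q' : M.Q} {σ σ' : M.K → List Sym} {k : M.K} {i : ι}
    (h : M.code q = .query i k q₁ q₀)
    (h' : M.Reach O t (if O i (σ k) then q₁ else q₀) σ q' σ') : M.Reach O (t + 1) q σ q' σ' := by
  obtain ⟨t', ht', h'⟩ := h'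
  exact ⟨t' + 1, by omega, fun s => by rw [add_right_comm, run, h, ← h']⟩

lemma run_halt {q : M.Q} {σ : M.K → List Sym} {b : Bool} (h : M.code q = .halt b) :
    M.run O 1 q σ = some b := by
  rw [run, h]

end Machine

/-! ### The verifier -/

namespace Verifier

/-- The stacks of the verifier: the unread input, the certificate, the scanned input (reversed), the
vertices that remain to be derived, a vertex or sentence in reverse, the oracle query, and a
counter. -/
inductive Stack
  | inp | cert | scanned | goals | rev | qry | cnt
  deriving DecidableEq

instance : Fintype Stack :=
  ⟨{.inp, .cert, .scanned, .goals, .rev, .qry, .cnt}, fun k => by cases k <;> decide⟩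

/-- The purposes of an oracle query: to check that the root is labelled by the goal sentence, to
check a hyperedge, to check the label of a leaf. -/
inductive Mode
  | root | edge | leaf
  deriving DecidableEq

instance : Fintype Mode := ⟨{.root, .edge, .leaf}, fun m => by cases m <;> decide⟩

/-- The oracle used for a purpose. -/
def Mode.oracle : Mode → OracleName
  | .edge => .edge
  | _ => .label

/-- The finite control carries at most one symbol: the argument `s` is the symbol still to be
written. The flag of `clear` remembers whether to go on with the next goal or with the next
sentence. -/
inductive State
  | readGoal | pushGoal (s : Sym)
  | readCount | pushCount
  | separate (m : Mode) | flush (m : Mode) | pushFlush (m : Mode) (s : Sym)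
  | block (m : Mode) | blockQuery (m : Mode) (s : Sym) | blockGoals (m : Mode) (s : Sym)
  | blockBits (m : Mode)
  | ask (m : Mode) | clear (found : Bool) | restore | pushRestore (s : Sym)
  | next | pushNext (s : Sym) | count | choose
  | rewind | pushRewind (s : Sym)
  | scan | scanInput (s : Sym) | scanQuery (s : Sym) | scanBits | unscan
  | halt (b : Bool)
  deriving DecidableEq, Fintype

open Stack State

/-- The program of the verifier.  The root of the tree proof is guessed and checked against the goal
sentence.  Then the vertices on the stack `goals` are treated one after the other, as long as the
counter lasts: either the certificate lists the children, which are checked by the edge oracle and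
become new goals, or the label of the vertex is compared with all sentences of the theory. -/
def program : State → Instr OracleName Stack State
  | readGoal => .pop inp fun
    | some (some b) => pushGoal (some b)
    | _ => readCount
  | pushGoal s => .push rev s readGoal
  | readCount => .pop inp fun
    | some (some _) => pushCount
    | _ => separate .root
  | pushCount => .push cnt none readCount
  | separate m => .push qry none (flush m)
  | flush m => .pop rev fun
    | some s => pushFlush m s
    | none => match m with
      | .leaf => ask .leaf
      | m => block m
  | pushFlush m s => .push qry s (flush m)
  -- Each child is copied to `qry` and to `goals` at once, so the vertices checked by the oracle are
  -- those that become goals. In mode `root` the list read is the guessed root; the label oracle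
  -- rejects it unless it is a single index.
  | block m => .pop cert fun
    | some (some true) => blockQuery m none
    | _ => ask m
  | blockQuery m s => .push qry s (blockGoals m s)
  | blockGoals m s => .push goals s (blockBits m)
  | blockBits m => .pop cert fun
    | some (some b) => blockQuery m (some b)
    | _ => block m
  | ask m => .query m.oracle qry (clear true) (match m with
    | .leaf => restore
    | _ => halt false)
  | clear found => .pop qry fun
    | some _ => clear found
    | none => if found then next else scan
  | restore => .pop qry fun
    | some (some b) => pushRestore (some b)
    | _ => clear false
  | pushRestore s => .push rev s restore
  -- Emptiness of `goals` is tested before the counter is charged, so a counter of `n` allows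
  -- exactly `n` removals.
  | next => .pop goals fun
    | some (some b) => pushNext (some b)
    | some none => count
    | none => halt true
  | pushNext s => .push rev s next
  | count => .pop cnt fun
    | some _ => choose
    | none => halt false
  | choose => .pop cert fun
    | some (some true) => separate .edge
    | _ => rewind
  | rewind => .pop inp fun
    | some s => pushRewind s
    | none => scan
  | pushRewind s => .push scanned s rewind
  | scan => .pop scanned fun
    | some s => scanInput s
    | none => halt false
  | scanInput s => .push inp s (scanQuery s)
  | scanQuery s => .push qry s scanBits
  -- The end of a sentence is noticed only at the separator of the preceding one, which `unscan`
  -- puts back.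
  | scanBits => .pop scanned fun
    | some (some b) => scanInput (some b)
    | some none => unscan
    | none => separate .leaf
  | unscan => .push scanned none (separate .leaf)
  | halt b => .halt b

/-- The verifier. -/
def machine : Machine OracleName where
  K := Stack
  Q := State
  fintypeK := inferInstance
  fintypeQ := inferInstance
  code := program
  start := readGoal
  input := inp
  cert := cert
  input_ne_cert := by decide

/-- The stack contents, listed one after the other. -/
def tapes (i c z g r q n : List Sym) : Stack → List Sym
  | inp => i
  | cert => c
  | scanned => z
  | goals => g
  | rev => r
  | qry => q
  | cnt => n

variable {O : OracleName → List Sym → Bool}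

/-- `Reach` for the verifier. -/
abbrev Reaches (O : OracleName → List Sym → Bool) (t : ℕ) (p : State) (σ : Stack → List Sym)
    (p' : State) (σ' : Stack → List Sym) : Prop :=
  machine.Reach O t p σ p' σ'

/-! ### Single steps and loops of the verifier. -/

section steps

variable {i c z g r q n : List Sym} {a : Sym} {t : ℕ} {p p₁ p' : State} {f : Option Sym → State}
  {σ' : Stack → List Sym}

lemma pop_inp (h : program p = .pop inp f)
    (h' : Reaches O t (f i.head?) (tapes i.tail c z g r q n) p' σ') :
    Reaches O (t + 1) p (tapes i c z g r q n) p' σ' := by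
  have hσ : tapes i.tail c z g r q n =
      Function.update (tapes i c z g r q n) inp i.tail := by
    ext1 k; cases k <;> rfl
  exact Machine.Reach.pop (M := machine) h (hσ ▸ h')

lemma push_inp (h : program p = .push inp a p₁)
    (h' : Reaches O t p₁ (tapes (a :: i) c z g r q n) p' σ') :
    Reaches O (t + 1) p (tapes i c z g r q n) p' σ' := by
  have hσ : tapes (a :: i) c z g r q n =
      Function.update (tapes i c z g r q n) inp (a :: i) := by
    ext1 k; cases k <;> rfl
  exact Machine.Reach.push (M := machine) h (hσ ▸ h')

lemma pop_cert (h : program p = .pop cert f)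
    (h' : Reaches O t (f c.head?) (tapes i c.tail z g r q n) p' σ') :
    Reaches O (t + 1) p (tapes i c z g r q n) p' σ' := by
  have hσ : tapes i c.tail z g r q n =
      Function.update (tapes i c z g r q n) cert c.tail := by
    ext1 k; cases k <;> rfl
  exact Machine.Reach.pop (M := machine) h (hσ ▸ h')

lemma pop_scanned (h : program p = .pop scanned f)
    (h' : Reaches O t (f z.head?) (tapes i c z.tail g r q n) p' σ') :
    Reaches O (t + 1) p (tapes i c z g r q n) p' σ' := by
  have hσ : tapes i c z.tail g r q n =
      Function.update (tapes i c z g r q n) scanned z.tail := by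
    ext1 k; cases k <;> rfl
  exact Machine.Reach.pop (M := machine) h (hσ ▸ h')

lemma push_scanned (h : program p = .push scanned a p₁)
    (h' : Reaches O t p₁ (tapes i c (a :: z) g r q n) p' σ') :
    Reaches O (t + 1) p (tapes i c z g r q n) p' σ' := by
  have hσ : tapes i c (a :: z) g r q n =
      Function.update (tapes i c z g r q n) scanned (a :: z) := by
    ext1 k; cases k <;> rfl
  exact Machine.Reach.push (M := machine) h (hσ ▸ h')

lemma pop_goals (h : program p = .pop goals f)
    (h' : Reaches O t (f g.head?) (tapes i c z g.tail r q n) p' σ') :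
    Reaches O (t + 1) p (tapes i c z g r q n) p' σ' := by
  have hσ : tapes i c z g.tail r q n =
      Function.update (tapes i c z g r q n) goals g.tail := by
    ext1 k; cases k <;> rfl
  exact Machine.Reach.pop (M := machine) h (hσ ▸ h')

lemma push_goals (h : program p = .push goals a p₁)
    (h' : Reaches O t p₁ (tapes i c z (a :: g) r q n) p' σ') :
    Reaches O (t + 1) p (tapes i c z g r q n) p' σ' := by
  have hσ : tapes i c z (a :: g) r q n =
      Function.update (tapes i c z g r q n) goals (a :: g) := by
    ext1 k; cases k <;> rfl
  exact Machine.Reach.push (M := machine) h (hσ ▸ h')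

lemma pop_rev (h : program p = .pop rev f)
    (h' : Reaches O t (f r.head?) (tapes i c z g r.tail q n) p' σ') :
    Reaches O (t + 1) p (tapes i c z g r q n) p' σ' := by
  have hσ : tapes i c z g r.tail q n =
      Function.update (tapes i c z g r q n) rev r.tail := by
    ext1 k; cases k <;> rfl
  exact Machine.Reach.pop (M := machine) h (hσ ▸ h')

lemma push_rev (h : program p = .push rev a p₁)
    (h' : Reaches O t p₁ (tapes i c z g (a :: r) q n) p' σ') :
    Reaches O (t + 1) p (tapes i c z g r q n) p' σ' := by
  have hσ : tapes i c z g (a :: r) q n =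
      Function.update (tapes i c z g r q n) rev (a :: r) := by
    ext1 k; cases k <;> rfl
  exact Machine.Reach.push (M := machine) h (hσ ▸ h')

lemma pop_qry (h : program p = .pop qry f)
    (h' : Reaches O t (f q.head?) (tapes i c z g r q.tail n) p' σ') :
    Reaches O (t + 1) p (tapes i c z g r q n) p' σ' := by
  have hσ : tapes i c z g r q.tail n =
      Function.update (tapes i c z g r q n) qry q.tail := by
    ext1 k; cases k <;> rfl
  exact Machine.Reach.pop (M := machine) h (hσ ▸ h')

lemma push_qry (h : program p = .push qry a p₁)
    (h' : Reaches O t p₁ (tapes i c z g r (a :: q) n) p' σ') :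
    Reaches O (t + 1) p (tapes i c z g r q n) p' σ' := by
  have hσ : tapes i c z g r (a :: q) n =
      Function.update (tapes i c z g r q n) qry (a :: q) := by
    ext1 k; cases k <;> rfl
  exact Machine.Reach.push (M := machine) h (hσ ▸ h')

lemma pop_cnt (h : program p = .pop cnt f)
    (h' : Reaches O t (f n.head?) (tapes i c z g r q n.tail) p' σ') :
    Reaches O (t + 1) p (tapes i c z g r q n) p' σ' := by
  have hσ : tapes i c z g r q n.tail =
      Function.update (tapes i c z g r q n) cnt n.tail := by
    ext1 k; cases k <;> rfl
  exact Machine.Reach.pop (M := machine) h (hσ ▸ h')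

lemma push_cnt (h : program p = .push cnt a p₁)
    (h' : Reaches O t p₁ (tapes i c z g r q (a :: n)) p' σ') :
    Reaches O (t + 1) p (tapes i c z g r q n) p' σ' := by
  have hσ : tapes i c z g r q (a :: n) =
      Function.update (tapes i c z g r q n) cnt (a :: n) := by
    ext1 k; cases k <;> rfl
  exact Machine.Reach.push (M := machine) h (hσ ▸ h')

lemma ask_query (m : Mode) : Reaches O 1 (ask m) (tapes i c z g r q n)
    (if O m.oracle q then clear true else match m with
      | .leaf => restore
      | _ => halt false) (tapes i c z g r q n) :=
  Machine.Reach.query (M := machine) (i := m.oracle) rfl (.refl _ _ _)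

end steps

@[simp] lemma field_nil : field [] = [none] := rfl

@[simp] lemma field_cons (b : Bool) (w : List Bool) : field (b :: w) = some b :: field w := rfl

section loops

variable (i c z g r q n : List Sym) (w : List Bool)

lemma reaches_readGoal : Reaches O (2 * w.length + 1)
    readGoal (tapes (field w ++ i) c z g r q n)
    readCount (tapes i c z g ((w.map some).reverse ++ r) q n) := by
  induction w generalizing r with
  | nil => exact pop_inp rfl (.refl _ _ _)
  | cons b w ih =>
    have := ih (some b :: r)
    exact pop_inp rfl (push_rev rfl (by simpa using this))

lemma reaches_readCount : Reaches O (2 * w.length + 1)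
    readCount (tapes (field w ++ i) c z g r q n)
    (separate .root) (tapes i c z g r q (List.replicate w.length none ++ n)) := by
  induction w generalizing n with
  | nil => exact pop_inp rfl (.refl _ _ _)
  | cons b w ih =>
    have := ih (none :: n)
    exact pop_inp rfl (push_cnt rfl (by simpa [List.replicate_succ'] using this))

/-- The state after the vertex or sentence has been written to the query. -/
def afterFlush : Mode → State
  | .leaf => ask .leaf
  | m => block m

lemma reaches_flush (m : Mode) : Reaches O (2 * r.length + 1)
    (flush m) (tapes i c z g r q n) (afterFlush m) (tapes i c z g [] (r.reverse ++ q) n) := by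
  induction r generalizing q with
  | nil => exact pop_rev rfl (by cases m <;> exact .refl _ _ _)
  | cons s r ih =>
    have := ih (s :: q)
    exact pop_rev rfl (push_qry rfl (by simpa using this))

lemma reaches_separate (m : Mode) : Reaches O (2 * w.length + 2)
    (separate m) (tapes i c z g (w.map some).reverse q n)
    (afterFlush m) (tapes i c z g [] (field w ++ q) n) := by
  have := reaches_flush (O := O) i c z g (w.map some).reverse (none :: q) n m
  exact push_qry rfl (by simpa [field] using this)

lemma reaches_clear (b : Bool) : Reaches O (q.length + 1)
    (clear b) (tapes i c z g r q n) (if b then next else scan) (tapes i c z g r [] n) := by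
  induction q with
  | nil => exact pop_qry rfl (.refl _ _ _)
  | cons s q ih => exact pop_qry rfl ih

lemma reaches_restore : Reaches O (2 * w.length + 1)
    restore (tapes i c z g r (field w ++ q) n)
    (clear false) (tapes i c z g ((w.map some).reverse ++ r) q n) := by
  induction w generalizing r with
  | nil => exact pop_qry rfl (.refl _ _ _)
  | cons b w ih =>
    have := ih (some b :: r)
    exact pop_qry rfl (push_rev rfl (by simpa using this))

lemma reaches_next : Reaches O (2 * w.length + 1)
    next (tapes i c z (field w ++ g) r q n)
    count (tapes i c z g ((w.map some).reverse ++ r) q n) := by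
  induction w generalizing r with
  | nil => exact pop_goals rfl (.refl _ _ _)
  | cons b w ih =>
    have := ih (some b :: r)
    exact pop_goals rfl (push_rev rfl (by simpa using this))

lemma reaches_rewind : Reaches O (2 * i.length + 1)
    rewind (tapes i c z g r q n) scan (tapes [] c (i.reverse ++ z) g r q n) := by
  induction i generalizing z with
  | nil => exact pop_inp rfl (.refl _ _ _)
  | cons s i ih =>
    have := ih (s :: z)
    exact pop_inp rfl (push_scanned rfl (by simpa using this))

/-- Reading `scanned` backwards and pushing restores the reading order, on `inp` and on `qry` alike.
If no sentence precedes, the loop ends at the empty stack instead of a separator. -/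
lemma reaches_scanBits (T : List (List Bool)) : Reaches O (3 * w.length + 2)
    scanBits (tapes i c ((w.map some).reverse ++ (T.flatMap field).reverse) g r q n)
    (separate .leaf)
      (tapes (w.map some ++ i) c (T.flatMap field).reverse g r (w.map some ++ q) n) := by
  induction w using List.reverseRecOn generalizing i q with
  | nil =>
    rcases T.eq_nil_or_concat with rfl | ⟨T, v, rfl⟩
    · exact (pop_scanned (t := 0) (p := scanBits) rfl (.refl _ _ _)).mono (by simp)
    · simp only [List.concat_eq_append, List.flatMap_append, List.flatMap_cons, List.flatMap_nil,
        List.append_nil, field, List.map_nil, List.reverse_nil, List.nil_append,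
        List.reverse_append, List.reverse_singleton, List.singleton_append]
      exact pop_scanned rfl (push_scanned rfl (.refl _ _ _))
  | append_singleton w b ih =>
    have := ih (some b :: i) (some b :: q)
    simp only [List.map_append, List.map_cons, List.map_nil, List.reverse_append,
      List.reverse_singleton, List.singleton_append, List.append_assoc]
    refine (pop_scanned rfl (push_inp rfl (push_qry rfl this))).mono ?_
    simp; omega

lemma reaches_scan (T : List (List Bool)) : Reaches O (3 * w.length + 5)
    scan (tapes i c ((T ++ [w]).flatMap field).reverse g r q n)
    (separate .leaf)
      (tapes (field w ++ i) c (T.flatMap field).reverse g r (field w ++ q) n) := by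
  have := reaches_scanBits (O := O) (none :: i) c g r (none :: q) n w T
  simp only [List.flatMap_append, List.flatMap_cons, List.flatMap_nil, List.append_nil, field,
    List.reverse_append, List.reverse_singleton, List.singleton_append, List.append_assoc]
  exact pop_scanned rfl (push_inp rfl (push_qry rfl this))

end loops

end Verifier

/-! ### Certificates, soundness, completeness and running time of the verifier. -/

namespace Verifier

open Stack State

variable {O : OracleName → List Sym → Bool}

/-- The certificate for a list of children, followed by an end marker. -/
def blockCode (ws : List (List Bool)) : List Sym :=
  ws.reverse.flatMap (fun w => some true :: (w.map some).reverse ++ [none]) ++ [some false]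

lemma length_blockCode_le {ws : List (List Bool)} {B : ℕ} (h : ∀ w ∈ ws, w.length ≤ B) :
    (blockCode ws).length ≤ ws.length * (B + 2) + 1 := by
  induction ws with
  | nil => simp [blockCode]
  | cons w ws ih =>
    have h1 := ih fun v hv => h v (by simp [hv])
    have h2 := h w (by simp)
    simp only [blockCode, List.reverse_cons, List.flatMap_append, List.length_append,
      List.length_cons, List.flatMap_cons, List.flatMap_nil, List.length_nil, List.length_reverse,
      List.length_map, add_mul] at h1 ⊢
    omega

section

variable (i c z g r q n : List Sym) (w : List Bool)

lemma reaches_blockBits (m : Mode) : Reaches O (3 * w.length + 1)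
    (blockBits m) (tapes i ((w.map some).reverse ++ none :: c) z g r q n)
    (block m) (tapes i c z (w.map some ++ g) r (w.map some ++ q) n) := by
  induction w using List.reverseRecOn generalizing g q with
  | nil => exact pop_cert rfl (.refl _ _ _)
  | append_singleton w b ih =>
    have := ih (some b :: g) (some b :: q)
    simp only [List.map_append, List.map_cons, List.map_nil, List.reverse_append,
      List.reverse_singleton, List.singleton_append, List.append_assoc]
    refine (pop_cert rfl (push_qry rfl (push_goals rfl this))).mono ?_
    simp; omega

lemma exists_reaches_blockCode (m : Mode) (ws : List (List Bool)) : ∃ t, Reaches O t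
    (block m) (tapes i (blockCode ws ++ c) z g r q n)
    (ask m) (tapes i c z (ws.flatMap field ++ g) r (ws.flatMap field ++ q) n) := by
  induction ws using List.reverseRecOn generalizing g q with
  | nil => exact ⟨1, pop_cert rfl (.refl _ _ _)⟩
  | append_singleton ws w ih =>
    obtain ⟨t, ht⟩ := ih (field w ++ g) (field w ++ q)
    have h1 := reaches_blockBits (O := O) i (blockCode ws ++ c) z (none :: g) r (none :: q) n w m
    have h2 : Reaches O _ (block m) (tapes i (some true :: ((w.map some).reverse ++
        none :: (blockCode ws ++ c))) z g r q n) _ _ :=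
      pop_cert rfl (push_qry rfl (push_goals rfl h1))
    have h3 := h2.trans (σ₃ := tapes i c z ((ws ++ [w]).flatMap field ++ g) r
      ((ws ++ [w]).flatMap field ++ q) n) (q₃ := ask m) (t₂ := t) (by simpa [field] using ht)
    exact ⟨_, by simpa [blockCode] using h3⟩

/-- Arbitrary certificates must be covered, also malformed ones: whatever is read amounts to some
list `ws`. Every symbol read puts at most one symbol on `goals`, which gives the length bound. The
two claims treat the states `block` and `blockBits`, which call each other. -/
lemma exists_reaches_block_aux (m : Mode) (k : ℕ) :
    (∀ c g q : List Sym, c.length = k → ∃ (ws : List (List Bool)) (c' : List Sym),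
      c'.length + (ws.flatMap field).length ≤ k ∧
      Reaches O (4 * k + 1) (block m) (tapes i c z g r q n)
        (ask m) (tapes i c' z (ws.flatMap field ++ g) r (ws.flatMap field ++ q) n)) ∧
    ∀ (c g q : List Sym) (w : List Bool), c.length = k →
      ∃ (ws : List (List Bool)) (c' : List Sym),
      c'.length + (ws.flatMap field).length ≤ k + (field w).length ∧
      Reaches O (4 * k + 2) (blockBits m) (tapes i c z (field w ++ g) r (field w ++ q) n)
        (ask m) (tapes i c' z (ws.flatMap field ++ g) r (ws.flatMap field ++ q) n) := by
  induction k with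
  | zero =>
    refine ⟨fun c g q hc => ?_, fun c g q w hc => ?_⟩ <;> obtain rfl := List.length_eq_zero_iff.1 hc
    · exact ⟨[], [], by simp, pop_cert rfl (.refl _ _ _)⟩
    · exact ⟨[w], [], by simp, pop_cert rfl (pop_cert rfl (by simpa using .refl _ _ _))⟩
  | succ k ih =>
    refine ⟨fun c g q hc => ?_, fun c g q w hc => ?_⟩ <;>
      obtain ⟨s, c, rfl⟩ := List.exists_cons_of_length_eq_add_one hc <;>
      simp only [List.length_cons, Nat.add_right_cancel_iff] at hc
    · have hcode : program (block m) = .pop cert (fun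
        | some (some true) => blockQuery m none
        | _ => ask m) := rfl
      rcases s with _ | _ | _
      · exact ⟨[], c, by simp; omega, (pop_cert (t := 0) hcode (.refl _ _ _)).mono (by omega)⟩
      · exact ⟨[], c, by simp; omega, (pop_cert (t := 0) hcode (.refl _ _ _)).mono (by omega)⟩
      · obtain ⟨ws, c', hl, h⟩ := ih.2 c g q [] hc
        refine ⟨ws, c', by simpa using hl, ?_⟩
        exact (pop_cert hcode (push_qry rfl (push_goals rfl h))).mono (by omega)
    · have hcode : program (blockBits m) = .pop cert (fun
        | some (some b) => blockQuery m (some b)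
        | _ => block m) := rfl
      rcases s with _ | b
      · obtain ⟨ws, c', hl, h⟩ := ih.1 c (field w ++ g) (field w ++ q) hc
        refine ⟨ws ++ [w], c', ?_, ?_⟩
        · rw [List.flatMap_append, List.length_append, List.flatMap_singleton]
          omega
        refine (pop_cert (t := 4 * k + 1) hcode ?_).mono (by omega)
        simpa using h
      · obtain ⟨ws, c', hl, h⟩ := ih.2 c g q (b :: w) hc
        refine ⟨ws, c', by rw [field_cons, List.length_cons] at hl; omega, ?_⟩
        exact (pop_cert hcode (push_qry rfl (push_goals rfl h))).mono (by omega)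

lemma exists_reaches_block (m : Mode) : ∃ (ws : List (List Bool)) (c' : List Sym),
    c'.length + (ws.flatMap field).length ≤ c.length ∧
    Reaches O (4 * c.length + 1) (block m) (tapes i c z g r q n)
      (ask m) (tapes i c' z (ws.flatMap field ++ g) r (ws.flatMap field ++ q) n) :=
  (exists_reaches_block_aux i z r n m c.length).1 c g q rfl

lemma reaches_scan_ask (d : List Bool) (T : List (List Bool)) :
    Reaches O (3 * w.length + 2 * d.length + 8)
      scan (tapes i c ((T ++ [w]).flatMap field).reverse g (d.map some).reverse [] n)
      (if O .label (field d ++ field w) then clear true else restore)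
      (tapes (field w ++ i) c (T.flatMap field).reverse g [] (field d ++ field w) n) := by
  have h1 := reaches_scan (O := O) i c g (d.map some).reverse [] n w T
  have h2 := reaches_separate (O := O) (field w ++ i) c (T.flatMap field).reverse g (field w) n d
    .leaf
  rw [List.append_nil] at h1
  exact ((h1.trans h2).trans (ask_query .leaf)).mono (by omega)

/-- One sentence of length `a` costs at most `11 * (a + 1) * (d + 1)`; this is the induction step
for the sum over the theory. -/
lemma scan_cost (a d t : ℕ) :
    4 * a + 4 * d + 11 + (11 * t * (d + 1) + 2) ≤ 11 * (t + (a + 1)) * (d + 1) + 2 := by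
  nlinarith [Nat.zero_le (a * d)]

@[simp] lemma length_field : (field w).length = w.length + 1 := by simp [field]

lemma reaches_scan_not_mem (d : List Bool) (T : List (List Bool)) (α : List Bool)
    (h : O .label (field d ++ field α) = false) :
    Reaches O (4 * α.length + 4 * d.length + 11)
      scan (tapes i c ((T ++ [α]).flatMap field).reverse g (d.map some).reverse [] n)
      scan (tapes (field α ++ i) c (T.flatMap field).reverse g (d.map some).reverse [] n) := by
  have h1 := reaches_scan_ask (O := O) i c g n α d T
  rw [h] at h1
  have h2 := reaches_restore (O := O) (field α ++ i) c (T.flatMap field).reverse g [] (field α) n d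
  have h3 := reaches_clear (O := O) (field α ++ i) c (T.flatMap field).reverse g
    ((d.map some).reverse ++ []) (field α) n false
  rw [List.append_nil] at h2 h3
  refine ((h1.trans h2).trans h3).mono ?_
  simp only [length_field]
  omega

/-- The scan stops at a match, so the theory may stay split between `scanned` and `inp`. What
survives is that the reversed first stack followed by the second spells the theory. -/
lemma exists_reaches_scan (d : List Bool) (T : List (List Bool))
    (h : ∃ α ∈ T, O .label (field d ++ field α) = true) :
    ∃ i' z', z'.reverse ++ i' = T.flatMap field ++ i ∧
      Reaches O (11 * (T.flatMap field).length * (d.length + 1) + 2)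
        scan (tapes i c (T.flatMap field).reverse g (d.map some).reverse [] n)
        next (tapes i' c z' g [] [] n) := by
  induction T using List.reverseRecOn generalizing i with
  | nil => simp at h
  | append_singleton T α ih =>
    have hcost := scan_cost α.length d.length (T.flatMap field).length
    by_cases hα : O .label (field d ++ field α) = true
    · have h1 := reaches_scan_ask (O := O) i c g n α d T
      rw [hα] at h1
      have h2 := reaches_clear (O := O) (field α ++ i) c (T.flatMap field).reverse g []
        (field d ++ field α) n true
      refine ⟨_, _, ?_, (h1.trans h2).mono ?_⟩
      · simp
      · simp only [List.length_append, length_field, List.flatMap_append, List.flatMap_cons,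
          List.flatMap_nil, List.append_nil]
        omega
    · have h1 := reaches_scan_not_mem (O := O) i c g n d T α (by simpa using hα)
      obtain ⟨i', z', hz, h2⟩ := ih (field α ++ i) (by
        obtain ⟨β, hβ, h⟩ := h
        rcases List.mem_append.1 hβ with hβ | hβ
        · exact ⟨β, hβ, h⟩
        · rw [List.mem_singleton.1 hβ] at h
          exact absurd h hα)
      refine ⟨i', z', by simpa using hz, (h1.trans h2).mono ?_⟩
      simpa using hcost

lemma run_scan_not_mem (d : List Bool) (T : List (List Bool))
    (h : ∀ α ∈ T, O .label (field d ++ field α) = false) :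
    machine.run O (11 * (T.flatMap field).length * (d.length + 1) + 2)
      scan (tapes i c (T.flatMap field).reverse g (d.map some).reverse [] n) = some false := by
  induction T using List.reverseRecOn generalizing i with
  | nil =>
    refine Machine.run_mono (t := 2) (by omega) ?_
    exact Machine.Reach.run_eq (M := machine) (t := 1) (s := 1)
      (pop_scanned (t := 0) (p := scan) rfl (.refl _ _ _)) (Machine.run_halt rfl)
  | append_singleton T α ih =>
    have hcost := scan_cost α.length d.length (T.flatMap field).length
    have h1 := reaches_scan_not_mem (O := O) i c g n d T α (h α (by simp))
    have h2 := ih (field α ++ i) fun β hβ => h β (by simp [hβ])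
    refine Machine.run_mono ?_ (h1.run_eq h2)
    simpa using hcost

end

/-- The goals can be derived from the theory `T` in at most `n` steps, according to the oracles. -/
inductive Derives (O : OracleName → List Sym → Bool) (T : List (List Bool)) :
    ℕ → List (List Bool) → Prop
  | nil (n : ℕ) : Derives O T n []
  | leaf {n : ℕ} {d α : List Bool} {gs : List (List Bool)} (hα : α ∈ T)
      (hd : O .label (field d ++ field α) = true) (h : Derives O T n gs) :
      Derives O T (n + 1) (d :: gs)
  | edge {n : ℕ} {d : List Bool} {ws gs : List (List Bool)}
      (hd : O .edge (ws.flatMap field ++ field d) = true) (h : Derives O T n (ws ++ gs)) :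
      Derives O T (n + 1) (d :: gs)

lemma Derives.length_le {T : List (List Bool)} {n : ℕ} {gs : List (List Bool)}
    (h : Derives O T n gs) : gs.length ≤ n := by
  induction h with
  | nil => simp
  | leaf _ _ _ ih => simpa using ih
  | edge _ _ ih =>
    simp only [List.length_append, List.length_cons] at ih ⊢
    omega

section

variable {T : List (List Bool)}

lemma reaches_choose (i z g : List Sym) (N : List Sym) (s : Sym) (d : List Bool) (c : List Sym) :
    Reaches O (2 * d.length + 3) next (tapes i c z (field d ++ g) [] [] (s :: N))
      (match c.head? with
        | some (some true) => separate .edge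
        | _ => rewind) (tapes i c.tail z g (d.map some).reverse [] N) := by
  have h1 := reaches_next (O := O) i c z g [] [] (s :: N) d
  rw [List.append_nil] at h1
  exact h1.trans (t₂ := 2) (pop_cnt rfl (pop_cert rfl (.refl _ _ _)))

/-- The time for the treatment of one goal. -/
def goalCost (X A : ℕ) : ℕ := 20 * (X + 1) * (A + 1)

/-- Any head of the certificate other than `some true` selects the leaf test, also the empty
certificate. Rewinding first makes the test independent of where the previous scan stopped. -/
lemma run_next_leaf {i z g c : List Sym} (hz : z.reverse ++ i = T.flatMap field) {N : List Sym}
    {s : Sym} {d : List Bool} (hc : c.head? ≠ some (some true)) {A : ℕ}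
    (hA : d.length + 1 ≤ A) :
    ((∃ α ∈ T, O .label (field d ++ field α) = true) → ∃ i' z',
        z'.reverse ++ i' = T.flatMap field ∧ Reaches O (goalCost (T.flatMap field).length A)
        next (tapes i c z (field d ++ g) [] [] (s :: N)) next (tapes i' c.tail z' g [] [] N)) ∧
    ((¬ ∃ α ∈ T, O .label (field d ++ field α) = true) →
      machine.run O (goalCost (T.flatMap field).length A)
        next (tapes i c z (field d ++ g) [] [] (s :: N)) = some false) := by
  have h1 := reaches_choose (O := O) i z g N s d c
  have h2 := reaches_rewind (O := O) i c.tail z g (d.map some).reverse [] N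
  have hi : i.length ≤ (T.flatMap field).length := by rw [← hz]; simp
  have hz' : i.reverse ++ z = (T.flatMap field).reverse := by rw [← hz]; simp
  have hq : (match c.head? with
        | some (some true) => separate .edge
        | _ => rewind) = rewind := by
    split
    · exact absurd ‹_› hc
    · rfl
  rw [hq] at h1
  rw [hz'] at h2
  have h3 := h1.trans h2
  have hcost : 2 * d.length + 3 + (2 * i.length + 1) +
      (11 * (T.flatMap field).length * (d.length + 1) + 2) ≤
      goalCost (T.flatMap field).length A := by
    unfold goalCost
    nlinarith [Nat.mul_le_mul_left (T.flatMap field).length hA]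
  refine ⟨fun h => ?_, fun h => ?_⟩
  · obtain ⟨i', z', hz', h4⟩ := exists_reaches_scan (O := O) [] c.tail g N d T h
    exact ⟨i', z', by simpa using hz', (h3.trans h4).mono hcost⟩
  · refine Machine.run_mono hcost (h3.run_eq (run_scan_not_mem [] c.tail g N d T ?_))
    simpa using h

lemma reaches_ask {m : Mode} {w : List Sym} (i z g c N : List Sym)
    (h : O m.oracle w = true) :
    Reaches O (w.length + 2) (ask m) (tapes i c z g [] w N) next (tapes i c z g [] [] N) := by
  have h1 := ask_query (O := O) (i := i) (c := c) (z := z) (g := g) (r := []) (q := w) (n := N) m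
  rw [if_pos h] at h1
  exact (h1.trans (reaches_clear i c z g [] w N true)).mono (by omega)

lemma run_ask {m : Mode} {w : List Sym} (i z g c N : List Sym) (hm : m ≠ .leaf)
    (h : ¬ O m.oracle w = true) : machine.run O 2 (ask m) (tapes i c z g [] w N) = some false := by
  have h1 := ask_query (O := O) (i := i) (c := c) (z := z) (g := g) (r := []) (q := w) (n := N) m
  rw [if_neg h] at h1
  cases m
  · exact h1.run_eq (Machine.run_halt rfl)
  · exact h1.run_eq (Machine.run_halt rfl)
  · exact absurd rfl hm

/-- Induction on the counter. The unread certificate and the goal stack together never grow, since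
children are paid for by certificate symbols; so a single bound `A` serves all rounds and each costs
at most `goalCost`. -/
theorem exists_run_next (A : ℕ) (N : List Sym) (gs : List (List Bool)) (c i z : List Sym)
    (hz : z.reverse ++ i = T.flatMap field) (hA : c.length + (gs.flatMap field).length ≤ A) :
    ∃ b, machine.run O ((N.length + 1) * goalCost (T.flatMap field).length A)
      next (tapes i c z (gs.flatMap field) [] [] N) = some b ∧
      (b = true → Derives O T N.length gs) := by
  have hpos : 20 * (A + 1) ≤ goalCost (T.flatMap field).length A := by
    unfold goalCost; nlinarith [Nat.zero_le ((T.flatMap field).length * (A + 1))]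
  induction N generalizing gs c i z with
  | nil =>
    cases gs with
    | nil =>
      refine ⟨true, Machine.run_mono (t := 2) (by rw [List.length_nil]; omega) ?_, fun _ => .nil _⟩
      exact Machine.Reach.run_eq (M := machine) (t := 1) (s := 1)
        (pop_goals (t := 0) (p := next) rfl (.refl _ _ _)) (Machine.run_halt rfl)
    | cons d gs =>
      have h1 := reaches_next (O := O) i c z (gs.flatMap field) [] [] [] d
      have h2 := h1.trans (pop_cnt (t := 0) rfl (.refl _ _ _))
      simp only [List.flatMap_cons, List.length_append, length_field] at hA
      refine ⟨false, Machine.run_mono ?_ (h2.run_eq (Machine.run_halt (b := false) rfl)), by simp⟩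
      rw [List.length_nil]
      omega
  | cons s N ih =>
    cases gs with
    | nil =>
      refine ⟨true, Machine.run_mono (t := 2) (by rw [List.length_cons, add_mul]; omega) ?_, fun _ => .nil _⟩
      exact Machine.Reach.run_eq (M := machine) (t := 1) (s := 1)
        (pop_goals (t := 0) (p := next) rfl (.refl _ _ _)) (Machine.run_halt rfl)
    | cons d gs =>
      simp only [List.flatMap_cons, List.length_append, length_field] at hA
      have hsplit : ((s :: N).length + 1) * goalCost (T.flatMap field).length A =
          goalCost (T.flatMap field).length A +
            (N.length + 1) * goalCost (T.flatMap field).length A := by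
        simp only [List.length_cons]; ring
      rw [hsplit]
      by_cases hc : c.head? = some (some true)
      · obtain ⟨c, rfl⟩ : ∃ c', c = some true :: c' := by
          cases c <;> simp_all
        have h1 := reaches_choose (O := O) i z (gs.flatMap field) N s d (some true :: c)
        have h2 := reaches_separate (O := O) i c z (gs.flatMap field) [] N d .edge
        obtain ⟨ws, c', hl, h3⟩ := exists_reaches_block (O := O) i c z (gs.flatMap field) []
          (field d ++ []) N .edge
        have h4 := (h1.trans h2).trans h3
        simp only [List.append_nil, ← List.flatMap_append] at h4
        simp only [List.length_cons] at hA
        by_cases hO : O .edge (ws.flatMap field ++ field d) = true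
        · have h5 := reaches_ask (m := .edge) i z ((ws ++ gs).flatMap field) c' N hO
          obtain ⟨b, hb, hb'⟩ := ih (ws ++ gs) c' i z hz (by
            simp only [List.flatMap_append, List.length_append]; omega)
          refine ⟨b, Machine.run_mono (Nat.add_le_add_right ?_ _) ((h4.trans h5).run_eq hb),
            fun h => .edge hO (hb' h)⟩
          simp only [List.length_append, length_field]
          omega
        · have h5 := run_ask (m := .edge) i z ((ws ++ gs).flatMap field) c' N (by simp) hO
          exact ⟨false, Machine.run_mono (by omega) (h4.run_eq h5), by simp⟩
      · have hleaf := run_next_leaf (O := O) (g := gs.flatMap field) hz (N := N) (s := s) (d := d)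
          hc (A := A) (by omega)
        by_cases hα : ∃ α ∈ T, O .label (field d ++ field α) = true
        · obtain ⟨i', z', hz', h⟩ := hleaf.1 hα
          obtain ⟨α, hα, hO⟩ := hα
          obtain ⟨b, hb, hb'⟩ := ih gs c.tail i' z' hz' (by rw [List.length_tail]; omega)
          exact ⟨b, h.run_eq hb, fun h => .leaf hα hO (hb' h)⟩
        · exact ⟨false, Machine.run_mono (by omega) (hleaf.2 hα), by simp⟩

/-- Each removal contributes one choice symbol and at most one block. At most `n` goals are pending
afterwards, so a block has length at most `n * (B + 2) + 1`. The number of steps is left open here,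
as `exists_verdict` bounds it. -/
theorem Derives.exists_cert {B n : ℕ} {gs : List (List Bool)} (h : Derives O T n gs)
    (hB : ∀ (ws : List (List Bool)) (d : List Bool), O .edge (ws.flatMap field ++ field d) = true → ∀ w ∈ ws, w.length ≤ B) :
    ∃ c : List Sym, c.length ≤ n * (n * (B + 2) + 2) ∧ ∀ (N i z : List Sym), N.length = n →
      z.reverse ++ i = T.flatMap field →
      ∃ t, machine.run O t next (tapes i c z (gs.flatMap field) [] [] N) = some true := by
  induction h with
  | nil n =>
    refine ⟨[], by simp, fun N i z _ _ => ⟨2, ?_⟩⟩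
    exact Machine.Reach.run_eq (M := machine) (t := 1) (s := 1)
      (pop_goals (t := 0) (p := next) rfl (.refl _ _ _)) (Machine.run_halt rfl)
  | @leaf n d α gs hα hd h ih =>
    obtain ⟨c, hc, hrun⟩ := ih
    refine ⟨some false :: c, ?_, fun N i z hN hz => ?_⟩
    · simp only [List.length_cons]
      nlinarith [Nat.zero_le (n * (B + 2))]
    · obtain ⟨s, N, rfl⟩ := List.exists_cons_of_length_eq_add_one hN
      obtain ⟨i', z', hz', h⟩ := (run_next_leaf (O := O) (g := gs.flatMap field) hz (N := N)
        (s := s) (d := d) (c := some false :: c) (by simp) le_rfl).1 ⟨α, hα, hd⟩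
      obtain ⟨t, ht⟩ := hrun N i' z' (by simpa using hN) hz'
      exact ⟨_, h.run_eq ht⟩
  | @edge n d ws gs hd h ih =>
    obtain ⟨c, hc, hrun⟩ := ih
    have hlen := h.length_le
    have hblock := length_blockCode_le (hB ws d hd)
    refine ⟨some true :: (blockCode ws ++ c), ?_, fun N i z hN hz => ?_⟩
    · simp only [List.length_cons, List.length_append] at hlen ⊢
      nlinarith [Nat.mul_le_mul_right (B + 2) (show ws.length ≤ n by omega),
        Nat.zero_le (n * (B + 2))]
    · obtain ⟨s, N, rfl⟩ := List.exists_cons_of_length_eq_add_one hN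
      obtain ⟨t, ht⟩ := hrun N i z (by simpa using hN) hz
      have h1 := reaches_choose (O := O) i z (gs.flatMap field) N s d
        (some true :: (blockCode ws ++ c))
      have h2 := reaches_separate (O := O) i (blockCode ws ++ c) z (gs.flatMap field) [] N d .edge
      obtain ⟨t', h3⟩ := exists_reaches_blockCode (O := O) i c z (gs.flatMap field) []
        (field d ++ []) N .edge ws
      have h4 := (h1.trans h2).trans h3
      simp only [List.append_nil, ← List.flatMap_append] at h4
      have h5 := reaches_ask (m := .edge) i z ((ws ++ gs).flatMap field) c N hd
      exact ⟨_, (h4.trans h5).run_eq ht⟩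

lemma init_eq (x y : List Sym) : machine.init x y = tapes x y [] [] [] [] [] := by
  ext1 k; cases k <;> rfl

/-- The input of the verifier. -/
def input (e : List Bool) (n : ℕ) (T : List (List Bool)) : List Sym :=
  field e ++ field (List.replicate n true) ++ T.flatMap field

lemma reaches_root (e : List Bool) (n : ℕ) (y : List Sym) :
    Reaches O (4 * e.length + 2 * n + 4)
      readGoal (tapes (input e n T) y [] [] [] [] [])
      (block .root) (tapes (T.flatMap field) y [] [] [] (field e) (List.replicate n none)) := by
  have h1 := reaches_readGoal (O := O) (field (List.replicate n true) ++ T.flatMap field) y [] [] []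
    [] [] e
  have h2 := reaches_readCount (O := O) (T.flatMap field) y [] [] ((e.map some).reverse ++ []) [] []
    (List.replicate n true)
  have h3 := reaches_separate (O := O) (T.flatMap field) y [] [] []
    (List.replicate n none) e .root
  simp only [List.append_nil, List.length_replicate] at h1 h2 h3
  rw [input, List.append_assoc]
  exact ((h1.trans h2).trans h3).mono (by omega)

/-- The instance is a yes-instance, according to the oracles. -/
def Accepts (O : OracleName → List Sym → Bool) (e : List Bool) (n : ℕ) (T : List (List Bool)) :
    Prop :=
  ∃ ws : List (List Bool), O .label (ws.flatMap field ++ field e) = true ∧ Derives O T n ws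

/-- The running time of the verifier. -/
noncomputable def time : Polynomial ℕ := 40 * (Polynomial.X + 1) ^ 3

theorem exists_verdict (e : List Bool) (n : ℕ) (T : List (List Bool)) (y : List Sym) :
    ∃ b, machine.verdict O (time.eval ((input e n T).length + y.length)) (input e n T) y = some b ∧
      (b = true → Accepts O e n T) := by
  have hx : (input e n T).length = e.length + n + (T.flatMap field).length + 2 := by
    simp only [input, List.length_append, length_field, List.length_replicate]; omega
  obtain ⟨ws, c', hl, h2⟩ := exists_reaches_block (O := O) (T.flatMap field) y [] [] [] (field e)
    (List.replicate n none) .root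
  have h3 := (reaches_root (O := O) (T := T) e n y).trans h2
  simp only [List.append_nil] at h3
  rw [Machine.verdict, init_eq]
  have htime : 4 * e.length + 2 * n + 4 + (4 * y.length + 1) + (y.length + e.length + 5) +
      (n + 1) * goalCost (T.flatMap field).length y.length ≤
      time.eval ((input e n T).length + y.length) := by
    rw [hx]
    simp only [time, Polynomial.eval_mul, Polynomial.eval_pow, Polynomial.eval_add,
      Polynomial.eval_X, Polynomial.eval_one, Polynomial.eval_ofNat, goalCost]
    -- The rounds cost at most `20 * s ^ 3`; the remaining terms are linear in `s` and fit into the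
    -- other half of `time`.
    set s := e.length + n + (T.flatMap field).length + 2 + y.length + 1 with hs
    have h1 : (n + 1) * (20 * ((T.flatMap field).length + 1) * (y.length + 1)) ≤ 20 * s ^ 3 := by
      calc _ = 20 * ((n + 1) * ((T.flatMap field).length + 1) * (y.length + 1)) := by ring
        _ ≤ 20 * (s * s * s) := by gcongr <;> omega
        _ = 20 * s ^ 3 := by ring
    have h2 : s ≤ s ^ 3 := Nat.le_self_pow (by simp) s
    omega
  by_cases hO : O .label (ws.flatMap field ++ field e) = true
  · have h4 := reaches_ask (m := .root) (T.flatMap field) [] (ws.flatMap field) c'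
      (List.replicate n none) hO
    obtain ⟨b, hb, hb'⟩ := exists_run_next (O := O) (T := T) y.length (List.replicate n none) ws c'
      (T.flatMap field) [] (by simp) hl
    rw [List.length_replicate] at hb hb'
    refine ⟨b, Machine.run_mono (le_trans ?_ htime) ((h3.trans h4).run_eq hb), fun h =>
      ⟨ws, hO, hb' h⟩⟩
    refine Nat.add_le_add_right ?_ _
    simp only [List.length_append, length_field]
    omega
  · have h4 := run_ask (m := .root) (T.flatMap field) [] (ws.flatMap field) c'
      (List.replicate n none) (by simp) hO
    exact ⟨false, Machine.run_mono (by omega) (h3.run_eq h4), by simp⟩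

theorem Accepts.exists_cert {e : List Bool} {n B : ℕ} (h : Accepts O e n T)
    (hB : ∀ i (ws : List (List Bool)) (d : List Bool),
      O i (ws.flatMap field ++ field d) = true → ∀ w ∈ ws, w.length ≤ B) :
    ∃ y : List Sym, y.length ≤ (n + 1) * (n * (B + 2) + 2) ∧
      machine.verdict O (time.eval ((input e n T).length + y.length)) (input e n T) y =
        some true := by
  obtain ⟨ws, hO, hd⟩ := h
  obtain ⟨c, hc, hrun⟩ := hd.exists_cert (hB .edge)
  refine ⟨blockCode ws ++ c, ?_, ?_⟩
  · have h1 := length_blockCode_le (hB _ ws e hO)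
    have h2 := Nat.mul_le_mul_right (B + 2) hd.length_le
    rw [List.length_append, add_mul]
    omega
  -- This run halts in time with some verdict `b`, while `hrun` yields acceptance after an unknown
  -- number of steps. Extended to a common length the two runs agree, so `b` is `true`.
  · obtain ⟨b, hb, -⟩ := exists_verdict (O := O) e n T (blockCode ws ++ c)
    obtain ⟨t', h2⟩ := exists_reaches_blockCode (O := O) (T.flatMap field) c [] [] [] (field e)
      (List.replicate n none) .root ws
    have h3 := (reaches_root (O := O) (T := T) e n (blockCode ws ++ c)).trans h2
    rw [List.append_nil] at h3
    have h4 := reaches_ask (m := .root) (T.flatMap field) [] (ws.flatMap field) c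
      (List.replicate n none) hO
    obtain ⟨t, ht⟩ := hrun (List.replicate n none) (T.flatMap field) [] (by simp) (by simp)
    have h5 := (h3.trans h4).run_eq ht
    rw [← init_eq] at h5
    have h6 := Machine.run_mono (Nat.le_add_left _
      (time.eval ((input e n T).length + (blockCode ws ++ c).length))) h5
    rw [hb, ← Machine.run_mono (Nat.le_add_right _ _) hb]
    exact h6

end

end Verifier

/-! ### Unique decoding of words and the oracles of a deriver. -/

lemma field_append_inj {v w : List Bool} {x y : List Sym} (h : field v ++ x = field w ++ y) :
    v = w ∧ x = y := by
  induction v generalizing w with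
  | nil => cases w <;> simp_all
  | cons b v ih =>
    cases w with
    | nil => simp at h
    | cons b' w =>
      simp only [Verifier.field_cons, List.cons_append, List.cons.injEq, Option.some.injEq] at h
      obtain ⟨rfl, rfl⟩ := ih h.2
      simp [h.1]

lemma flatMap_field_injective : Function.Injective fun ws : List (List Bool) => ws.flatMap field := by
  intro vs
  induction vs with
  | nil => intro ws h; cases ws <;> simp_all [field]
  | cons v vs ih =>
    intro ws h
    cases ws with
    | nil => simp [field] at h
    | cons w ws =>
      obtain ⟨rfl, h'⟩ := field_append_inj (by simpa only [List.flatMap_cons] using h)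
      rw [ih h']

lemma polynomial_eval_mono (p : Polynomial ℕ) : Monotone fun n => p.eval n := by
  intro a b h
  simp only [Polynomial.eval_eq_sum, Polynomial.sum]
  gcongr

namespace Deriver

variable {L : Logic.{u, v}} (D : Deriver L) (num : D.Numbering) (T : Finset L.Sentence) (η : D.C)

lemma index_injective : Function.Injective (D.index num T η) := by
  intro v w h
  have : (num T η v : ℕ) + 1 = num T η w + 1 := Nat.eq_of_testBit_eq fun i => by
    rw [index, index] at h
    rw [Nat.testBit_eq_inth, Nat.testBit_eq_inth, h]
  exact (num T η).injective (Fin.ext (by omega))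

/-- With an arbitrary list `ws` in the query, unique decoding shows that a positive answer forces
`ws` to be one index. This validates the guessed root. -/
lemma oracle_label_iff (ws : List (List Bool)) (α : L.Sentence) :
    D.oracle num T η .label (ws.flatMap field ++ field (L.enc α)) = true ↔
      ∃ w, ws = [D.index num T η w] ∧ (D.out T η).label w = α := by
  simp only [oracle, decide_eq_true_eq]
  constructor
  · rintro ⟨w, β, h, hβ⟩
    have h' : (ws ++ [L.enc α]).flatMap field =
        ([D.index num T η w] ++ [L.enc β]).flatMap field := by simpa using h
    obtain ⟨h1, h2⟩ := List.append_inj' (flatMap_field_injective h') rfl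
    exact ⟨w, h1, hβ.trans (L.enc_injective (by simpa using h2.symm))⟩
  · rintro ⟨w, rfl, rfl⟩
    exact ⟨w, _, by simp, rfl⟩

open Classical in
lemma oracle_edge_iff (ws : List (List Bool)) (d : List Bool) :
    D.oracle num T η .edge (ws.flatMap field ++ field d) = true ↔
      ∃ (vs : List (D.out T η).V) (v : (D.out T η).V), ws = vs.map (D.index num T η) ∧ d = D.index num T η v ∧
        (vs.toFinset, v) ∈ (D.out T η).E := by
  simp only [oracle, decide_eq_true_eq]
  constructor
  · rintro ⟨vs, v, h, he⟩
    have h' : (ws ++ [d]).flatMap field =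
        (vs.map (D.index num T η) ++ [D.index num T η v]).flatMap field := by
      simpa [List.flatMap_map] using h
    obtain ⟨h1, h2⟩ := List.append_inj' (flatMap_field_injective h') rfl
    exact ⟨vs, v, h1, by simpa using h2, he⟩
  · rintro ⟨vs, v, rfl, rfl, he⟩
    exact ⟨vs, v, by simp [List.flatMap_map], he⟩

open Classical in
-- The goals always are indices of vertices, as the edge oracle accepts no other words; injectivity
-- of indices and of `L.enc` recovers vertices and sentences.
lemma derives_iff (l : List L.Sentence) (n : ℕ) (gs : List (D.out l.toFinset η).V) :
    Verifier.Derives (D.oracle num l.toFinset η) (l.map L.enc) n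
        (gs.map (D.index num l.toFinset η)) ↔
      (D.out l.toFinset η).DischargeIn l.toFinset n gs := by
  constructor
  · generalize hw : gs.map (D.index num l.toFinset η) = ws
    intro h
    induction h generalizing gs with
    | nil => obtain rfl := List.map_eq_nil_iff.1 hw; exact .nil _
    | leaf hα hd _ ih =>
      obtain ⟨v, gs, rfl, rfl, rfl⟩ := List.map_eq_cons_iff.1 hw
      obtain ⟨α, hα, rfl⟩ := List.mem_map.1 hα
      obtain ⟨w, hw, hwα⟩ := (D.oracle_label_iff num _ η [_] α).1 (by simpa using hd)
      obtain rfl := D.index_injective num _ η (by simpa using hw)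
      exact .leaf (by rwa [hwα, List.mem_toFinset]) (ih gs rfl)
    | edge hd _ ih =>
      obtain ⟨v, gs, rfl, rfl, rfl⟩ := List.map_eq_cons_iff.1 hw
      obtain ⟨vs, v', rfl, hv, he⟩ := (D.oracle_edge_iff num _ η _ _).1 hd
      obtain rfl := D.index_injective num _ η hv
      exact .edge he (ih (vs ++ gs) (by simp))
  · intro h
    induction h with
    | nil => exact .nil _
    | @leaf n d gs hd _ ih =>
      refine .leaf (List.mem_map_of_mem (List.mem_toFinset.1 hd)) ?_ ih
      simpa using (D.oracle_label_iff num _ η [_] _).2 ⟨d, rfl, rfl⟩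
    | @edge n d ws gs hd _ ih =>
      exact .edge ((D.oracle_edge_iff num _ η _ _).2 ⟨ws, d, rfl, rfl, hd⟩) (by simpa using ih)

open Classical in
lemma accepts_iff (l : List L.Sentence) (n : ℕ) :
    Verifier.Accepts (D.oracle num l.toFinset η) (L.enc η) n (l.map L.enc) ↔
      D.HasTreeProof l.toFinset η n := by
  rw [D.hasTreeProof_iff]
  constructor
  · rintro ⟨ws, hO, hd⟩
    obtain ⟨w, rfl, hw⟩ := (D.oracle_label_iff num _ η _ _).1 hO
    exact ⟨w, hw, (D.derives_iff num η l n [w]).1 hd⟩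
  · rintro ⟨w, hw, hd⟩
    exact ⟨[_], (D.oracle_label_iff num _ η _ _).2 ⟨w, rfl, hw⟩, (D.derives_iff num η l n [w]).2 hd⟩

lemma length_index_le (w : (D.out T η).V) :
    (D.index num T η w).length ≤ Nat.size (Fintype.card (D.out T η).V) := by
  rw [index, Nat.size_eq_bits_len]
  -- Indices start at `1`, so the largest one equals the number of vertices.
  exact Nat.size_le_size (num T η w).2

lemma length_le_of_oracle {B : ℕ} (hB : ∀ w, (D.index num T η w).length ≤ B) (i : OracleName)
    (ws : List (List Bool)) (d : List Bool)
    (h : D.oracle num T η i (ws.flatMap field ++ field d) = true) : ∀ w ∈ ws, w.length ≤ B := by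
  cases i with
  | edge =>
    obtain ⟨vs, v, rfl, -, -⟩ := (D.oracle_edge_iff num _ η _ _).1 h
    simpa using fun a _ => hB a
  | label =>
    simp only [oracle, decide_eq_true_eq] at h
    obtain ⟨w, β, h, hβ⟩ := h
    have h' : (ws ++ [d]).flatMap field =
        ([D.index num T η w] ++ [L.enc β]).flatMap field := by simpa using h
    obtain ⟨rfl, -⟩ := List.append_inj' (flatMap_field_injective h') rfl
    simpa using hB w

lemma word_eq (l : List L.Sentence) (n : ℕ) :
    (D.MTPUnary num).word (l, η, n) = Verifier.input (L.enc η) n (l.map L.enc) := by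
  simp [MTPUnary, Verifier.input, List.flatMap_map]

open Classical in
-- The word has length at least the number of sentences in the theory and at least the length of
-- each, so the theory contributes at most `x * r.eval x` and `η` one more `r.eval x`.
lemma size_add_size_le {r : Polynomial ℕ} (hr : ∀ α, L.size α ≤ r.eval (L.enc α).length)
    (l : List L.Sentence) (n : ℕ) :
    L.theorySize l.toFinset + L.size η ≤
      ((Polynomial.X + 1) * r).eval ((D.MTPUnary num).word (l, η, n)).length := by
  set x := ((D.MTPUnary num).word (l, η, n)).length with hx
  have hlen : x = (L.enc η).length + n + (l.flatMap fun α => field (L.enc α)).length + 2 := by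
    simp only [hx, MTPUnary, List.length_append, Verifier.length_field, List.length_replicate]
    omega
  have hη : L.size η ≤ r.eval x := (hr η).trans (polynomial_eval_mono r (by omega))
  have hα : ∀ α ∈ l, (L.enc α).length + 1 ≤ (l.flatMap fun α => field (L.enc α)).length := by
    intro α hα
    rw [List.length_flatMap, ← Verifier.length_field]
    exact List.le_sum_of_mem (List.mem_map_of_mem (f := fun α => (field (L.enc α)).length) hα)
  have hcard : l.length ≤ (l.flatMap fun α => field (L.enc α)).length := by
    rw [List.length_flatMap]
    simpa only [List.length_map] using
      List.length_le_sum_of_one_le (l.map fun α => (field (L.enc α)).length) (by simp)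
  have hT : L.theorySize l.toFinset ≤ x * r.eval x := by
    calc L.theorySize l.toFinset ≤ l.toFinset.card • r.eval x :=
          Finset.sum_le_card_nsmul _ _ _ fun α h => (hr α).trans (polynomial_eval_mono r (by
            have := hα α (List.mem_toFinset.1 h); omega))
      _ ≤ x * r.eval x := by
          have := l.toFinset_card_le
          rw [smul_eq_mul]
          gcongr
          omega
  simp only [Polynomial.eval_mul, Polynomial.eval_add, Polynomial.eval_X, add_mul, one_mul]
  omega

end Deriver

end MinProof

/-! ### Membership in NP. -/

theorem mainTheorem8 (L : MinProof.Logic.{u, v}) (D : MinProof.Deriver L)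
    (hexp : D.IsExponential) (num : D.Numbering) (hidx : D.HasPolyIndices) :
    (D.MTPUnary num).InNP := by
  classical
  obtain ⟨p, hp⟩ := hidx
  obtain ⟨r, hr⟩ := L.size_le
  set b : Polynomial ℕ := p.comp ((Polynomial.X + 1) * r) with hb
  -- The polynomial `b` bounds index lengths by the length of the instance. The certificate bound is
  -- that of `Accepts.exists_cert`, with the instance length in place of `n`, which is smaller
  -- because `n` is given in unary.
  refine ⟨MinProof.Verifier.machine, MinProof.Verifier.time,
    (Polynomial.X + 1) * (Polynomial.X * (b + 2) + 2), fun ⟨l, η, n⟩ => ?_⟩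
  have hB : ∀ w, (D.index num l.toFinset η w).length ≤
      b.eval ((D.MTPUnary num).word (l, η, n)).length := fun w => by
    rw [hb, Polynomial.eval_comp]
    exact ((D.length_index_le num _ η w).trans (hp _ η)).trans
      (MinProof.polynomial_eval_mono p (D.size_add_size_le num η hr l n))
  have hn : n ≤ ((D.MTPUnary num).word (l, η, n)).length := by
    simp only [MinProof.Deriver.MTPUnary, List.length_append, MinProof.Verifier.length_field,
      List.length_replicate]
    omega
  have hO : (D.MTPUnary num).oracle (l, η, n) = D.oracle num l.toFinset η := by
    simp only [MinProof.Deriver.MTPUnary]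
  have hY : (D.MTPUnary num).Yes (l, η, n) ↔ D.HasTreeProof l.toFinset η n := by
    simp only [MinProof.Deriver.MTPUnary]
  rw [hO, hY, ← D.accepts_iff num]
  rw [D.word_eq] at hB hn ⊢
  refine ⟨fun y => ?_, fun h => ?_, ?_⟩
  · obtain ⟨b, hb, -⟩ := MinProof.Verifier.exists_verdict (O := D.oracle num l.toFinset η)
      (L.enc η) n (l.map L.enc) y
    exact ⟨b, hb⟩
  · obtain ⟨y, hy, hv⟩ := h.exists_cert (D.length_le_of_oracle num _ η hB)
    refine ⟨y, hy.trans ?_, hv⟩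
    simp only [Polynomial.eval_mul, Polynomial.eval_add, Polynomial.eval_X, Polynomial.eval_one,
      Polynomial.eval_ofNat]
    gcongr
  · rintro ⟨y, -, hy⟩
    obtain ⟨b, hb, hb'⟩ := MinProof.Verifier.exists_verdict (O := D.oracle num l.toFinset η)
      (L.enc η) n (l.map L.enc) y
    exact hb' (Option.some.inj (hb.symm.trans hy))
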